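/- Let $\Phi:[0,\infty)\to[0,\infty)$ be a Young function satisfying the $\Delta_2$-condition, that is, $\Phi(0)=0$, $\Phi$ is convex and strictly increasing, and there is $K>0$ with $\Phi(2x)\le K\Phi(x)$ for all $x>0$. For a measure space $(\Omega,\mu)$ let $L_\Phi(\Omega,\mu)$ be the space of ($\mu$-a.e. classes of) measurable functions $f:\Omega\to\mathbb{R}$ with $\int_\Omega\Phi(|f|)\,d\mu<\infty$, normed by $\|f\|_\Phi=\inf\{r>0:\int_\Omega\Phi(|f|/r)\,d\mu\le 1\}$. Write $L_\Phi[0,\infty)$ when $\Omega=[0,\infty)$ with Lebesgue measure, and $\ell_\Phi$ when $\Omega=\mathbb{N}$ with counting measure. For a metric space $M$ with a distinguished point $0$ (for a normed space, its origin), let $\operatorname{Lip}_0(M)$ be the space of all Lipschitz functions $f:M\to\mathbb{R}$ with $f(0)=0$, normed by $\|f\|_{\operatorname{Lip}}=\sup_{x\ne y}|f(x)-f(y)|/d(x,y)$. Let $\simeq$ denote linear isomorphism of Banach spaces (a linear homeomorphism), and let $\bigoplus_{\ell_\infty}X_n$ be the space of sequences $(x_n)_n$ with $x_n\in X_n$ and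 $\sup_n\|x_n\|<\infty$, normed by this supremum. If $(\alpha_n)_n$ is any sequence of strictly positive real numbers with $\lim_{n\to\infty}\alpha_n=0$, then \[\operatorname{Lip}_0(L_\Phi[0,\infty))\simeq\bigoplus_{\ell_\infty}\operatorname{Lip}_0(\ell_{\alpha_n\Phi}),\] where $\ell_{\alpha_n\Phi}$ is the Orlicz sequence space associated with the function $\alpha_n\Phi$. In particular, for every $1\le p<\infty$, $\operatorname{Lip}_0(\ell_p)\simeq\operatorname{Lip}_0(L_p)$, both for $L_p=L_p[0,\infty)$ and for $L_p=L_p[0,1]$ (real scalars, Lebesgue measure). -/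

import Mathlib

open MeasureTheory
open scoped NNReal ENNReal

noncomputable section

/-! ### The space `Lip₀(M)` -/

section LipZero

variable (M : Type*) [MetricSpace M] (x₀ : M)

/-- The real vector space of all real-valued Lipschitz functions on `M` that vanish at the
distinguished point `x₀`. -/
def lipZeroSubmodule : Submodule ℝ (M → ℝ) where
  carrier := {f | f x₀ = 0 ∧ ∃ K : ℝ≥0, LipschitzWith K f}
  zero_mem' := ⟨rfl, 0, LipschitzWith.const 0⟩
  add_mem' := by
    rintro f g ⟨hf, K, hK⟩ ⟨hg, L, hL⟩
    exact ⟨by simp [hf, hg], K + L, hK.add hL⟩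
  smul_mem' := by
    rintro c f ⟨hf, K, hK⟩
    refine ⟨by simp [hf], ‖c‖₊ * K, LipschitzWith.of_dist_le_mul fun x y => ?_⟩
    have h := hK.dist_le_mul x y
    simp only [Pi.smul_apply, dist_smul₀, NNReal.coe_mul, coe_nnnorm, mul_assoc]
    gcongr

/-- The type of all real-valued Lipschitz functions on `M` that vanish at `x₀`. -/
def LipZero : Type _ := lipZeroSubmodule M x₀

namespace LipZero

variable {M x₀}

instance : CoeFun (LipZero M x₀) (fun _ => M → ℝ) := ⟨fun f => f.1⟩

instance : AddCommGroup (LipZero M x₀) := inferInstanceAs (AddCommGroup (lipZeroSubmodule M x₀))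

instance : Module ℝ (LipZero M x₀) := inferInstanceAs (Module ℝ (lipZeroSubmodule M x₀))

/-- The norm of `f` is its smallest Lipschitz constant, `sup_{x ≠ y} |f x - f y| / d(x, y)`
(the pairs with `x = y` contribute `0 / 0 = 0`). -/
instance : Norm (LipZero M x₀) := ⟨fun f => ⨆ p : M × M, |f p.1 - f p.2| / dist p.1 p.2⟩

lemma norm_def (f : LipZero M x₀) : ‖f‖ = ⨆ p : M × M, |f p.1 - f p.2| / dist p.1 p.2 := rfl

lemma bddAbove (f : LipZero M x₀) :
    BddAbove (Set.range fun p : M × M => |f p.1 - f p.2| / dist p.1 p.2) := by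
  obtain ⟨-, K, hK⟩ := f.2
  refine ⟨K, ?_⟩
  rintro _ ⟨⟨x, y⟩, rfl⟩
  exact div_le_of_le_mul₀ dist_nonneg K.2 (by simpa [Real.dist_eq] using hK.dist_le_mul x y)

lemma abs_sub_le (f : LipZero M x₀) (x y : M) : |f x - f y| ≤ ‖f‖ * dist x y := by
  rcases eq_or_ne x y with rfl | h
  · simp
  · rw [← div_le_iff₀ (dist_pos.2 h)]
    exact le_ciSup f.bddAbove (x, y)

lemma norm_le_of_forall (f : LipZero M x₀) {C : ℝ} (hC : 0 ≤ C)
    (h : ∀ x y, |f x - f y| ≤ C * dist x y) : ‖f‖ ≤ C := by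
  have : Nonempty (M × M) := ⟨(x₀, x₀)⟩
  exact ciSup_le fun p => div_le_of_le_mul₀ dist_nonneg hC (h p.1 p.2)

lemma norm_nonneg' (f : LipZero M x₀) : 0 ≤ ‖f‖ :=
  Real.iSup_nonneg fun _ => by positivity

lemma core : NormedSpace.Core ℝ (LipZero M x₀) where
  norm_nonneg := norm_nonneg'
  norm_smul c f := by
    have h : ∀ p : M × M, |(c • f) p.1 - (c • f) p.2| / dist p.1 p.2
        = ‖c‖ * (|f p.1 - f p.2| / dist p.1 p.2) := fun p => by
      change |c * f p.1 - c * f p.2| / dist p.1 p.2 = _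
      rw [← mul_sub, abs_mul, Real.norm_eq_abs, mul_div_assoc]
    rw [norm_def, norm_def, Real.mul_iSup_of_nonneg (norm_nonneg c)]
    exact iSup_congr h
  norm_triangle f g := by
    refine norm_le_of_forall _ (add_nonneg (norm_nonneg' f) (norm_nonneg' g)) fun x y => ?_
    change |f x + g x - (f y + g y)| ≤ _
    rw [add_sub_add_comm, add_mul]
    exact (abs_add_le _ _).trans (add_le_add (abs_sub_le f x y) (abs_sub_le g x y))
  norm_eq_zero_iff f := by
    constructor
    · intro h
      refine Subtype.ext (funext fun x => ?_)
      have h1 := abs_sub_le f x x₀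
      have h2 : f x₀ = 0 := f.2.1
      rw [h, zero_mul, h2, sub_zero] at h1
      exact abs_nonpos_iff.1 h1
    · rintro rfl
      refine le_antisymm (norm_le_of_forall _ le_rfl fun x y => ?_) (norm_nonneg' _)
      change |(0 : ℝ) - 0| ≤ _
      simp

instance : NormedAddCommGroup (LipZero M x₀) := NormedAddCommGroup.ofCore core

instance : NormedSpace ℝ (LipZero M x₀) := NormedSpace.ofCore core

end LipZero

end LipZero

/-! ### Young functions and Orlicz spaces -/

/-- A Young function `Φ : [0, ∞) → [0, ∞)` satisfying the `Δ₂`-condition. -/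
structure YoungFunctionDelta2 where
  toFun : ℝ≥0 → ℝ≥0
  map_zero' : toFun 0 = 0
  convex' : ConvexOn ℝ≥0 Set.univ toFun
  strictMono' : StrictMono toFun
  delta2' : ∃ K : ℝ≥0, 0 < K ∧ ∀ x, 0 < x → toFun (2 * x) ≤ K * toFun x

namespace YoungFunctionDelta2

instance : CoeFun YoungFunctionDelta2 (fun _ => ℝ≥0 → ℝ≥0) := ⟨toFun⟩

variable (Φ : YoungFunctionDelta2)

lemma map_zero : Φ 0 = 0 := Φ.map_zero'

lemma mono : Monotone Φ := Φ.strictMono'.monotone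

lemma measurable : Measurable Φ := Φ.mono.measurable

lemma convex {a b : ℝ≥0} (hab : a + b = 1) (x y : ℝ≥0) :
    Φ (a * x + b * y) ≤ a * Φ x + b * Φ y :=
  Φ.convex'.2 (Set.mem_univ x) (Set.mem_univ y) (zero_le) (zero_le) hab

lemma map_mul_le {c : ℝ≥0} (hc : c ≤ 1) (x : ℝ≥0) : Φ (c * x) ≤ c * Φ x := by
  have h := Φ.convex (add_tsub_cancel_of_le hc) x 0
  simpa [Φ.map_zero] using h

/-- The function `x ↦ α Φ(x)`, for `α > 0`. -/
def scale (α : ℝ≥0) (hα : 0 < α) : YoungFunctionDelta2 where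
  toFun x := α * Φ x
  map_zero' := by simp [Φ.map_zero]
  convex' := ⟨convex_univ, fun x _ y _ a b _ _ hab => by
    have h := Φ.convex hab x y
    simp only [smul_eq_mul]
    calc α * Φ (a * x + b * y) ≤ α * (a * Φ x + b * Φ y) := by gcongr
      _ = a * (α * Φ x) + b * (α * Φ y) := by ring⟩
  strictMono' x y h := mul_lt_mul_of_pos_left (Φ.strictMono' h) hα
  delta2' := by
    obtain ⟨K, hK, h⟩ := Φ.delta2'
    refine ⟨K, hK, fun x hx => ?_⟩
    calc α * Φ (2 * x) ≤ α * (K * Φ x) := by gcongr; exact h x hx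
      _ = K * (α * Φ x) := by ring

lemma exists_delta2 : ∃ K : ℝ≥0, ∀ x, Φ (2 * x) ≤ K * Φ x := by
  obtain ⟨K, -, h⟩ := Φ.delta2'
  refine ⟨K, fun x => ?_⟩
  rcases (zero_le : 0 ≤ x).eq_or_lt with rfl | hx
  · simp [Φ.map_zero]
  · exact h x hx

lemma exists_delta2_pow (n : ℕ) : ∃ K : ℝ≥0, ∀ x, Φ (2 ^ n * x) ≤ K * Φ x := by
  obtain ⟨K, hK⟩ := Φ.exists_delta2
  refine ⟨K ^ n, fun x => ?_⟩
  induction n with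
  | zero => simp
  | succ n ih =>
    calc Φ (2 ^ (n + 1) * x) = Φ (2 * (2 ^ n * x)) := by ring_nf
      _ ≤ K * Φ (2 ^ n * x) := hK _
      _ ≤ K * (K ^ n * Φ x) := by gcongr
      _ = K ^ (n + 1) * Φ x := by ring

end YoungFunctionDelta2

section Orlicz

variable {Ω : Type*} [MeasurableSpace Ω] (Φ : YoungFunctionDelta2) (μ : Measure Ω)

/-- The vector space of all (classes modulo `μ`-a.e. equality of) measurable functions
`f : Ω → ℝ` with `∫ Φ(|f|) dμ < ∞`. -/
def orliczSubmodule : Submodule ℝ (Ω →ₘ[μ] ℝ) where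
  carrier := {f | ∫⁻ x, (Φ ‖f x‖₊ : ℝ≥0∞) ∂μ < ∞}
  zero_mem' := by
    have h : ∫⁻ x, (Φ ‖(0 : Ω →ₘ[μ] ℝ) x‖₊ : ℝ≥0∞) ∂μ = ∫⁻ _, 0 ∂μ := by
      refine lintegral_congr_ae ?_
      filter_upwards [AEEqFun.coeFn_zero (μ := μ) (β := ℝ)] with x hx
      simp [hx, Φ.map_zero]
    simp [h]
  add_mem' := by
    intro f g hf hg
    obtain ⟨K, hK⟩ := Φ.exists_delta2
    simp only [Set.mem_ofPred_eq] at hf hg ⊢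
    have h : ∀ᵐ x ∂μ, (Φ ‖(f + g) x‖₊ : ℝ≥0∞) ≤ K * Φ ‖f x‖₊ + K * Φ ‖g x‖₊ := by
      filter_upwards [AEEqFun.coeFn_add f g] with x hx
      rw [hx]
      norm_cast
      rcases le_total ‖f x‖₊ ‖g x‖₊ with hle | hle
      · refine le_trans ?_ le_add_self
        refine (Φ.mono ?_).trans (hK _)
        rw [two_mul]
        exact (nnnorm_add_le _ _).trans (by gcongr)
      · refine le_trans ?_ le_self_add
        refine (Φ.mono ?_).trans (hK _)
        rw [two_mul]
        exact (nnnorm_add_le _ _).trans (by gcongr)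
    refine (lintegral_mono_ae h).trans_lt ?_
    have hm : Measurable fun x => (Φ ‖f x‖₊ : ℝ≥0∞) :=
      (Φ.measurable.comp f.measurable.nnnorm).coe_nnreal_ennreal
    rw [lintegral_add_left (hm.const_mul _), lintegral_const_mul' _ _ ENNReal.coe_ne_top,
      lintegral_const_mul' _ _ ENNReal.coe_ne_top]
    exact ENNReal.add_lt_top.2 ⟨ENNReal.mul_lt_top ENNReal.coe_lt_top hf,
      ENNReal.mul_lt_top ENNReal.coe_lt_top hg⟩
  smul_mem' := by
    intro c f hf
    obtain ⟨n, hn⟩ := pow_unbounded_of_one_lt ‖c‖₊ (one_lt_two : (1 : ℝ≥0) < 2)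
    obtain ⟨K, hK⟩ := Φ.exists_delta2_pow n
    simp only [Set.mem_ofPred_eq] at hf ⊢
    have h : ∀ᵐ x ∂μ, (Φ ‖(c • f) x‖₊ : ℝ≥0∞) ≤ K * Φ ‖f x‖₊ := by
      filter_upwards [AEEqFun.coeFn_smul c f] with x hx
      rw [hx, Pi.smul_apply, nnnorm_smul]
      norm_cast
      exact (Φ.mono (by gcongr)).trans (hK _)
    refine (lintegral_mono_ae h).trans_lt ?_
    rw [lintegral_const_mul' _ _ ENNReal.coe_ne_top]
    exact ENNReal.mul_lt_top ENNReal.coe_lt_top hf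

/-- The Orlicz space `L_Φ(Ω, μ)`. -/
def OrliczSpace : Type _ := orliczSubmodule Φ μ

namespace OrliczSpace

variable {Φ μ}

instance : CoeFun (OrliczSpace Φ μ) (fun _ => Ω → ℝ) := ⟨fun f => f.1⟩

instance : AddCommGroup (OrliczSpace Φ μ) := inferInstanceAs (AddCommGroup (orliczSubmodule Φ μ))

instance : Module ℝ (OrliczSpace Φ μ) := inferInstanceAs (Module ℝ (orliczSubmodule Φ μ))

/-- The set of all `r > 0` with `∫ Φ(|f| / r) dμ ≤ 1`. -/
def gaugeSet (f : OrliczSpace Φ μ) : Set ℝ≥0 :=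
  {r | 0 < r ∧ ∫⁻ x, (Φ (‖f x‖₊ / r) : ℝ≥0∞) ∂μ ≤ 1}

/-- The norm `‖f‖_Φ = inf {r > 0 : ∫ Φ(|f| / r) dμ ≤ 1}`. -/
instance : Norm (OrliczSpace Φ μ) := ⟨fun f => ((sInf (gaugeSet f) : ℝ≥0) : ℝ)⟩

lemma norm_def (f : OrliczSpace Φ μ) : ‖f‖ = ((sInf (gaugeSet f) : ℝ≥0) : ℝ) := rfl

lemma measurable_comp (f : OrliczSpace Φ μ) (r : ℝ≥0) :
    Measurable fun x => (Φ (‖f x‖₊ / r) : ℝ≥0∞) :=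
  (Φ.measurable.comp (f.1.measurable.nnnorm.div_const r)).coe_nnreal_ennreal

lemma gaugeSet_nonempty (f : OrliczSpace Φ μ) : (gaugeSet f).Nonempty := by
  have hf : ∫⁻ x, (Φ ‖f x‖₊ : ℝ≥0∞) ∂μ < ∞ := f.2
  lift ∫⁻ x, (Φ ‖f x‖₊ : ℝ≥0∞) ∂μ to ℝ≥0 using hf.ne with A hA
  have h1 : (1 : ℝ≥0) ≤ 1 + A := le_self_add
  have h0 : (0 : ℝ≥0) < 1 + A := one_pos.trans_le h1
  refine ⟨1 + A, h0, ?_⟩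
  have hle : ∀ x, (Φ (‖f x‖₊ / (1 + A)) : ℝ≥0∞) ≤ ((1 + A)⁻¹ : ℝ≥0) * Φ ‖f x‖₊ := fun x => by
    norm_cast
    rw [div_eq_inv_mul]
    exact Φ.map_mul_le (inv_le_one_of_one_le₀ h1) _
  refine (lintegral_mono hle).trans ?_
  rw [lintegral_const_mul' _ _ ENNReal.coe_ne_top, ← hA]
  norm_cast
  rw [inv_mul_le_iff₀ h0, mul_one]
  exact le_add_self

lemma gaugeSet_add {f g : OrliczSpace Φ μ} {r s : ℝ≥0} (hr : r ∈ gaugeSet f)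
    (hs : s ∈ gaugeSet g) : r + s ∈ gaugeSet (f + g) := by
  have hr0 := hr.1
  have hs0 := hs.1
  have h0 : 0 < r + s := add_pos hr0 hs0
  refine ⟨h0, ?_⟩
  have hab : r / (r + s) + s / (r + s) = 1 := by rw [← add_div, div_self h0.ne']
  have hle : ∀ᵐ x ∂μ, (Φ (‖(f + g) x‖₊ / (r + s)) : ℝ≥0∞) ≤
      (r / (r + s) : ℝ≥0) * Φ (‖f x‖₊ / r) + (s / (r + s) : ℝ≥0) * Φ (‖g x‖₊ / s) := by
    filter_upwards [AEEqFun.coeFn_add f.1 g.1] with x hx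
    have hx' : (f + g) x = f x + g x := hx
    rw [hx']
    norm_cast
    refine (Φ.mono ?_).trans (Φ.convex hab _ _)
    have e1 : r / (r + s) * (‖f x‖₊ / r) = ‖f x‖₊ / (r + s) := by field_simp
    have e2 : s / (r + s) * (‖g x‖₊ / s) = ‖g x‖₊ / (r + s) := by field_simp
    rw [e1, e2, ← add_div]
    gcongr
    exact nnnorm_add_le _ _
  refine (lintegral_mono_ae hle).trans ?_
  rw [lintegral_add_left ((measurable_comp f r).const_mul _),
    lintegral_const_mul' _ _ ENNReal.coe_ne_top, lintegral_const_mul' _ _ ENNReal.coe_ne_top]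
  calc _ ≤ ((r / (r + s) : ℝ≥0) : ℝ≥0∞) * 1 + ((s / (r + s) : ℝ≥0) : ℝ≥0∞) * 1 := by
        gcongr
        exacts [hr.2, hs.2]
    _ = 1 := by rw [mul_one, mul_one]; exact_mod_cast hab

lemma gaugeSet_smul {f : OrliczSpace Φ μ} {r : ℝ≥0} {c : ℝ} (hc : c ≠ 0)
    (hr : r ∈ gaugeSet f) : ‖c‖₊ * r ∈ gaugeSet (c • f) := by
  have hc' : 0 < ‖c‖₊ := nnnorm_pos.2 hc
  refine ⟨mul_pos hc' hr.1, le_trans (le_of_eq (lintegral_congr_ae ?_)) hr.2⟩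
  filter_upwards [AEEqFun.coeFn_smul c f.1] with x hx
  have hx' : (c • f) x = c * f x := hx
  rw [hx', nnnorm_mul, mul_div_mul_left _ _ hc'.ne']

lemma norm_zero' : ‖(0 : OrliczSpace Φ μ)‖ = 0 := by
  rw [norm_def, NNReal.coe_eq_zero]
  refine le_antisymm (le_of_forall_pos_le_add fun ε hε => ?_) zero_le
  rw [zero_add]
  refine csInf_le (OrderBot.bddBelow _) ⟨hε, ?_⟩
  refine le_trans (le_of_eq ?_) zero_le_one
  have h : ∫⁻ x, (Φ (‖(0 : OrliczSpace Φ μ) x‖₊ / ε) : ℝ≥0∞) ∂μ = ∫⁻ _, 0 ∂μ := by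
    refine lintegral_congr_ae ?_
    filter_upwards [AEEqFun.coeFn_zero (μ := μ) (β := ℝ)] with x hx
    have hx' : (0 : OrliczSpace Φ μ) x = 0 := hx
    simp [hx', Φ.map_zero]
  simp [h]

lemma norm_smul_le' {c : ℝ} (hc : c ≠ 0) (f : OrliczSpace Φ μ) : ‖c • f‖ ≤ ‖c‖ * ‖f‖ := by
  have hc' : 0 < ‖c‖₊ := nnnorm_pos.2 hc
  rw [norm_def, norm_def, ← coe_nnnorm, ← NNReal.coe_mul, NNReal.coe_le_coe,
    ← div_le_iff₀' hc']
  refine le_csInf (gaugeSet_nonempty f) fun r hr => ?_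
  rw [div_le_iff₀' hc']
  exact csInf_le (OrderBot.bddBelow _) (gaugeSet_smul hc hr)

lemma core : NormedSpace.Core ℝ (OrliczSpace Φ μ) where
  norm_nonneg f := NNReal.coe_nonneg _
  norm_smul c f := by
    rcases eq_or_ne c 0 with rfl | hc
    · rw [zero_smul, norm_zero', norm_zero, zero_mul]
    · refine le_antisymm (norm_smul_le' hc f) ?_
      have h := norm_smul_le' (inv_ne_zero hc) (c • f)
      rw [smul_smul, inv_mul_cancel₀ hc, one_smul, norm_inv] at h
      rwa [le_inv_mul_iff₀ (norm_pos_iff.2 hc)] at h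
  norm_triangle f g := by
    rw [norm_def, norm_def, norm_def, ← NNReal.coe_add, NNReal.coe_le_coe]
    refine le_of_forall_pos_le_add fun ε hε => ?_
    obtain ⟨r, hr, hr'⟩ := exists_lt_of_csInf_lt (gaugeSet_nonempty f)
      (lt_add_of_pos_right (sInf (gaugeSet f)) (half_pos hε))
    obtain ⟨s, hs, hs'⟩ := exists_lt_of_csInf_lt (gaugeSet_nonempty g)
      (lt_add_of_pos_right (sInf (gaugeSet g)) (half_pos hε))
    calc sInf (gaugeSet (f + g)) ≤ r + s :=
          csInf_le (OrderBot.bddBelow _) (gaugeSet_add hr hs)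
      _ ≤ (sInf (gaugeSet f) + ε / 2) + (sInf (gaugeSet g) + ε / 2) :=
          add_le_add hr'.le hs'.le
      _ = sInf (gaugeSet f) + sInf (gaugeSet g) + ε := by
          rw [add_add_add_comm, add_halves]
  norm_eq_zero_iff f := by
    constructor
    swap
    · rintro rfl
      exact norm_zero'
    intro h
    rw [norm_def, NNReal.coe_eq_zero] at h
    have key : ∫⁻ x, (Φ ‖f x‖₊ : ℝ≥0∞) ∂μ = 0 := by
      refine le_antisymm (ENNReal.le_of_forall_pos_le_add fun ε hε _ => ?_) zero_le
      rw [zero_add]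
      obtain ⟨r, hr, hr'⟩ := exists_lt_of_csInf_lt (gaugeSet_nonempty f)
        (h.trans_lt (lt_min hε one_pos))
      have hr1 : r ≤ 1 := hr'.le.trans (min_le_right _ _)
      have hrε : r ≤ ε := hr'.le.trans (min_le_left _ _)
      have hle : ∀ x, (Φ ‖f x‖₊ : ℝ≥0∞) ≤ r * Φ (‖f x‖₊ / r) := fun x => by
        norm_cast
        have := Φ.map_mul_le hr1 (‖f x‖₊ / r)
        rwa [mul_div_cancel₀ _ hr.1.ne'] at this
      refine (lintegral_mono hle).trans ?_
      rw [lintegral_const_mul' _ _ ENNReal.coe_ne_top]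
      calc (r : ℝ≥0∞) * _ ≤ r * 1 := by gcongr; exact hr.2
        _ ≤ ε := by rw [mul_one]; exact_mod_cast hrε
    have hm : Measurable fun x => (Φ ‖f x‖₊ : ℝ≥0∞) :=
      (Φ.measurable.comp f.1.measurable.nnnorm).coe_nnreal_ennreal
    rw [lintegral_eq_zero_iff hm] at key
    refine Subtype.ext (AEEqFun.ext ?_)
    filter_upwards [key, AEEqFun.coeFn_zero (μ := μ) (β := ℝ)] with x hx h0
    refine Eq.trans ?_ h0.symm
    have hx' : Φ ‖f x‖₊ = Φ 0 := by
      rw [Φ.map_zero]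
      exact ENNReal.coe_eq_zero.1 hx
    exact nnnorm_eq_zero.1 (Φ.strictMono'.injective hx')

instance : NormedAddCommGroup (OrliczSpace Φ μ) := NormedAddCommGroup.ofCore core

instance : NormedSpace ℝ (OrliczSpace Φ μ) := NormedSpace.ofCore core

end OrliczSpace

/-- The Orlicz function space `L_Φ[0, ∞)` with respect to Lebesgue measure. -/
abbrev OrliczHalfLine : Type := OrliczSpace Φ (volume.restrict (Set.Ici (0 : ℝ)))

/-- The Orlicz sequence space `ℓ_Φ`, i.e. `L_Φ` of the counting measure on `ℕ`. -/
abbrev OrliczSeq : Type := OrliczSpace Φ (Measure.count : Measure ℕ)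

end Orlicz

end

/-! ### Bounded families of operators and `ℓ_∞`-sums -/

/-! All the isomorphisms come from Pełczyński's decomposition method
(`IsComplementedIn.nonempty_equiv`): two Banach spaces that are complemented in each other are
isomorphic once one of them is isomorphic to its own `ℓ_∞`-sum. Three ingredients feed it.

First, `Lip₀(X)` is isomorphic to its `ℓ_∞`-sum for every normed space `X`
(`LipZero.nonempty_equiv_lpInfty`). It is isomorphic to the `ℓ_∞`-sum of copies of `Lip₀` of the
unit ball: a Lipschitz function is recovered from its restrictions to growing balls, and conversely
a bounded sequence of functions on the ball can be planted on far-apart balls of `X`.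

Second, pointwise approximation of points becomes complementation of function spaces
(`LipZero.isComplementedIn_of_tendsto`). If `b n ∘ a n` tends pointwise to the identity and factors
through `Z n`, then `f ↦ (f ∘ b n)` has as left inverse the ultrafilter limit of `g n ∘ a n`. When
the factors are linear and `a n ∘ b n` is the identity, each `Lip₀(Z n)` is in turn complemented in
`Lip₀(X)`, so `Lip₀(X) ≃ ⨁ Lip₀(Z n)`.

Third, averaging over the intervals `[kα, (k+1)α)` is a norm-one projection of `L_Φ[0, ∞)` onto step
functions, a copy of `ℓ_{αΦ}`. By Jensen it does not increase the modular, and by Lebesgue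
differentiation, Fatou and `Δ₂` it converges strongly to the identity as `α → 0`.

For `Φ(x) = x ^ p` the step functions embed isometrically in the single space `ℓ_p`, whatever the
masses of the cells. The approximations thus factor through `ℓ_p`, which is itself complemented in
`L_p`; this settles `[0, ∞)` and `[0, 1]` together. -/

section LpInfty

variable {ι : Type*} {V : Type*} [NormedAddCommGroup V] [NormedSpace ℝ V]
  {E : ι → Type*} [∀ i, NormedAddCommGroup (E i)] [∀ i, NormedSpace ℝ (E i)]

/-- The operator into an `ℓ_∞`-sum whose coordinates are a given uniformly bounded family of
operators. -/
noncomputable def lpInftyLift (T : ∀ i, V →L[ℝ] E i) (C : ℝ) (hC : 0 ≤ C)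
    (hT : ∀ i v, ‖T i v‖ ≤ C * ‖v‖) : V →L[ℝ] lp E ∞ :=
  LinearMap.mkContinuous
    { toFun := fun v => ⟨fun i => T i v, memℓp_infty ⟨C * ‖v‖, by
        rintro _ ⟨i, rfl⟩
        exact hT i v⟩⟩
      map_add' := fun v w => by
        ext i
        exact (T i).map_add v w
      map_smul' := fun c v => by
        ext i
        exact (T i).map_smul c v }
    C fun v => lp.norm_le_of_forall_le (mul_nonneg hC (norm_nonneg v)) fun i => hT i v

@[simp]
lemma lpInftyLift_apply (T : ∀ i, V →L[ℝ] E i) (C : ℝ) (hC : 0 ≤ C)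
    (hT : ∀ i v, ‖T i v‖ ≤ C * ‖v‖) (v : V) (i : ι) :
    lpInftyLift T C hC hT v i = T i v := rfl

variable (E) in
/-- The coordinate operators of an `ℓ_∞`-sum. -/
noncomputable def lpInftyEval (i : ι) : lp E ∞ →L[ℝ] E i :=
  LinearMap.mkContinuous
    { toFun := fun f => f i
      map_add' := fun _ _ => rfl
      map_smul' := fun _ _ => rfl }
    1 fun f => by
      rw [one_mul]
      exact lp.norm_apply_le_norm ENNReal.top_ne_zero f i

@[simp]
lemma lpInftyEval_apply (i : ι) (f : lp E ∞) : lpInftyEval E i f = f i := rfl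

lemma norm_lpInfty_apply_le {ι : Type*} {E : ι → Type*} [∀ i, NormedAddCommGroup (E i)]
    (f : lp E ∞) (i : ι) : ‖f i‖ ≤ ‖f‖ :=
  lp.norm_apply_le_norm ENNReal.top_ne_zero f i

end LpInfty

section LpInftyEquiv

variable {V W : Type*} [NormedAddCommGroup V] [NormedSpace ℝ V]
  [NormedAddCommGroup W] [NormedSpace ℝ W]

/-- A uniformly bounded family of operators acts diagonally between `ℓ_∞`-sums. -/
noncomputable def lpInftyMap {ι : Type*} {E F : ι → Type*} [∀ i, NormedAddCommGroup (E i)]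
    [∀ i, NormedSpace ℝ (E i)] [∀ i, NormedAddCommGroup (F i)] [∀ i, NormedSpace ℝ (F i)]
    (T : ∀ i, E i →L[ℝ] F i) (C : ℝ) (hC : 0 ≤ C) (hT : ∀ i v, ‖T i v‖ ≤ C * ‖v‖) :
    lp E ∞ →L[ℝ] lp F ∞ :=
  lpInftyLift (fun i => (T i).comp (lpInftyEval E i)) C hC fun i v =>
    (hT i (v i)).trans (mul_le_mul_of_nonneg_left (norm_lpInfty_apply_le v i) hC)

@[simp]
lemma lpInftyMap_apply {ι : Type*} {E F : ι → Type*} [∀ i, NormedAddCommGroup (E i)]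
    [∀ i, NormedSpace ℝ (E i)] [∀ i, NormedAddCommGroup (F i)] [∀ i, NormedSpace ℝ (F i)]
    (T : ∀ i, E i →L[ℝ] F i) (C : ℝ) (hC : 0 ≤ C) (hT : ∀ i v, ‖T i v‖ ≤ C * ‖v‖)
    (v : lp E ∞) (i : ι) : lpInftyMap T C hC hT v i = T i (v i) := rfl

/-- Isomorphic spaces have isomorphic `ℓ_∞`-sums. -/
noncomputable def lpInftyCongr (e : V ≃L[ℝ] W) :
    lp (fun _ : ℕ => V) ∞ ≃L[ℝ] lp (fun _ : ℕ => W) ∞ :=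
  ContinuousLinearEquiv.equivOfInverse
    (lpInftyMap (fun _ => (e : V →L[ℝ] W)) _ (norm_nonneg _) fun _ => (e : V →L[ℝ] W).le_opNorm)
    (lpInftyMap (fun _ => (e.symm : W →L[ℝ] V)) _ (norm_nonneg _)
      fun _ => (e.symm : W →L[ℝ] V).le_opNorm)
    (fun v => by ext i; simp) (fun v => by ext i; simp)

variable (V W) in
/-- `ℓ_∞(V × W) ≃ ℓ_∞(V) × ℓ_∞(W)`. -/
noncomputable def lpInftyProd :
    lp (fun _ : ℕ => V × W) ∞ ≃L[ℝ] lp (fun _ : ℕ => V) ∞ × lp (fun _ : ℕ => W) ∞ :=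
  ContinuousLinearEquiv.equivOfInverse
    ((lpInftyMap (fun _ => ContinuousLinearMap.fst ℝ V W) 1 zero_le_one fun _ v => by
        simpa using norm_fst_le v).prod
      (lpInftyMap (fun _ => ContinuousLinearMap.snd ℝ V W) 1 zero_le_one fun _ v => by
        simpa using norm_snd_le v))
    (lpInftyLift (fun i => ((lpInftyEval (fun _ : ℕ => V) i).comp
        (ContinuousLinearMap.fst ℝ _ _)).prod ((lpInftyEval (fun _ : ℕ => W) i).comp
        (ContinuousLinearMap.snd ℝ _ _))) 1 zero_le_one fun i v => by
      rw [one_mul]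
      exact max_le_max (norm_lpInfty_apply_le v.1 i) (norm_lpInfty_apply_le v.2 i))
    (fun v => by ext i <;> simp)
    (fun v => by
      refine Prod.ext ?_ ?_ <;> ext i <;> simp)

variable (V) in
/-- `ℓ_∞(V) ≃ V × ℓ_∞(V)`. -/
noncomputable def lpInftySucc :
    lp (fun _ : ℕ => V) ∞ ≃L[ℝ] V × lp (fun _ : ℕ => V) ∞ :=
  ContinuousLinearEquiv.equivOfInverse
    ((lpInftyEval (fun _ : ℕ => V) 0).prod
      (lpInftyLift (fun i => lpInftyEval (fun _ : ℕ => V) (i + 1)) 1 zero_le_one fun i v => by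
        simpa using norm_lpInfty_apply_le v (i + 1)))
    (lpInftyLift (fun i => Nat.casesOn i (ContinuousLinearMap.fst ℝ _ _)
        fun i => (lpInftyEval (fun _ : ℕ => V) i).comp (ContinuousLinearMap.snd ℝ _ _))
        1 zero_le_one fun i v => by
      rw [one_mul]
      cases i with
      | zero => exact norm_fst_le v
      | succ i => exact (norm_lpInfty_apply_le v.2 i).trans (norm_snd_le v))
    (fun v => by
      ext i
      cases i <;> simp)
    (fun v => by
      refine Prod.ext ?_ ?_
      · simp
      · ext i
        simp)

variable (V) in
/-- `ℓ_∞(ℓ_∞(V)) ≃ ℓ_∞(V)`. -/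
noncomputable def lpInftyIterate :
    lp (fun _ : ℕ => lp (fun _ : ℕ => V) ∞) ∞ ≃L[ℝ] lp (fun _ : ℕ => V) ∞ :=
  ContinuousLinearEquiv.equivOfInverse
    (lpInftyLift (fun i => (lpInftyEval (fun _ : ℕ => V) i.unpair.2).comp
        (lpInftyEval (fun _ : ℕ => lp (fun _ : ℕ => V) ∞) i.unpair.1)) 1 zero_le_one fun i v => by
      rw [one_mul]
      exact (norm_lpInfty_apply_le _ _).trans (norm_lpInfty_apply_le _ _))
    (lpInftyLift (fun i => lpInftyLift (fun j => lpInftyEval (fun _ : ℕ => V) (Nat.pair i j))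
        1 zero_le_one fun j v => by
          rw [one_mul]
          exact norm_lpInfty_apply_le _ _) 1 zero_le_one fun i v => by
      rw [one_mul]
      exact lp.norm_le_of_forall_le (norm_nonneg v) fun j =>
        norm_lpInfty_apply_le v (Nat.pair i j))
    (fun v => by
      ext i j
      simp)
    (fun v => by
      ext i
      simp)

end LpInftyEquiv

/-! ### Complemented subspaces and Pełczyński's decomposition method -/

section Complemented

/-- `V` is isomorphic to a complemented subspace of `W`. -/
def IsComplementedIn (V W : Type*) [NormedAddCommGroup V] [NormedSpace ℝ V]
    [NormedAddCommGroup W] [NormedSpace ℝ W] : Prop :=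
  ∃ (S : V →L[ℝ] W) (T : W →L[ℝ] V), ∀ v, T (S v) = v

variable {U V W : Type*} [NormedAddCommGroup U] [NormedSpace ℝ U]
  [NormedAddCommGroup V] [NormedSpace ℝ V] [NormedAddCommGroup W] [NormedSpace ℝ W]

lemma IsComplementedIn.trans (h : IsComplementedIn U V) (h' : IsComplementedIn V W) :
    IsComplementedIn U W := by
  obtain ⟨S, T, h⟩ := h
  obtain ⟨S', T', h'⟩ := h'
  exact ⟨S'.comp S, T.comp T', fun v => by simp [h, h']⟩

lemma ContinuousLinearEquiv.isComplementedIn (e : V ≃L[ℝ] W) : IsComplementedIn V W :=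
  ⟨e, e.symm, by simp⟩

/-- Pełczyński's decomposition method for spaces isomorphic to their `ℓ_∞`-sum. -/
theorem IsComplementedIn.nonempty_equiv (h : IsComplementedIn V W) (h' : IsComplementedIn W V)
    (e : W ≃L[ℝ] lp (fun _ : ℕ => W) ∞) : Nonempty (V ≃L[ℝ] W) := by
  obtain ⟨S, T, h⟩ := h
  obtain ⟨S', T', h'⟩ := h'
  -- A left inverse `T` of `S` splits off its kernel. With `K = ker T`, `W ≃ ℓ_∞(W) ≃ ℓ_∞(V) ×
  -- ℓ_∞(K)` absorbs one more copy of `V`.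
  let e₁ : W ≃L[ℝ] V × T.ker := ContinuousLinearEquiv.equivOfRightInverse T S h
  let e₂ : V ≃L[ℝ] W × T'.ker := ContinuousLinearEquiv.equivOfRightInverse T' S' h'
  let e₃ : W ≃L[ℝ] lp (fun _ : ℕ => V) ∞ × lp (fun _ : ℕ => T.ker) ∞ :=
    (e.trans (lpInftyCongr e₁)).trans (lpInftyProd V T.ker)
  let e₄ : W ≃L[ℝ] V × W :=
    ((e₃.trans ((lpInftySucc V).prodCongr (.refl ℝ _))).trans
      (ContinuousLinearEquiv.prodAssoc ℝ _ _ _)).trans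
      ((ContinuousLinearEquiv.refl ℝ V).prodCongr e₃.symm)
  let e₅ : W ≃L[ℝ] W × W :=
    (e.trans (lpInftySucc W)).trans ((ContinuousLinearEquiv.refl ℝ W).prodCongr e.symm)
  let e₆ : V ≃L[ℝ] W × V :=
    ((e₂.trans (e₅.prodCongr (.refl ℝ _))).trans
      (ContinuousLinearEquiv.prodAssoc ℝ _ _ _)).trans
      ((ContinuousLinearEquiv.refl ℝ W).prodCongr e₂.symm)
  -- `V ≃ W × V ≃ V × W ≃ W`.
  exact ⟨(e₆.trans (ContinuousLinearEquiv.prodComm ℝ W V)).trans e₄.symm⟩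

end Complemented

/-! ### Operators between spaces of Lipschitz functions -/

section HyperLim

open Filter Topology

/-- The limit of a sequence of reals along a fixed free ultrafilter. -/
noncomputable def hyperLim (u : ℕ → ℝ) : ℝ := limUnder (hyperfilter ℕ : Filter ℕ) u

/-- Compactness of `[-C, C]`: every bounded sequence converges along the ultrafilter, so `hyperLim`
is linear on bounded sequences and keeps their bounds. -/
lemma tendsto_hyperLim {u : ℕ → ℝ} {C : ℝ} (hu : ∀ n, |u n| ≤ C) :
    Tendsto u (hyperfilter ℕ : Filter ℕ) (𝓝 (hyperLim u)) := by
  refine tendsto_nhds_limUnder ?_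
  obtain ⟨l, -, hl⟩ := (isCompact_Icc (a := -C) (b := C)).ultrafilter_le_nhds'
    ((hyperfilter ℕ).map u)
    (Eventually.of_forall (p := fun n => u n ∈ Set.Icc (-C) C) fun n => abs_le.1 (hu n))
  exact ⟨l, hl⟩

lemma hyperLim_eq {u : ℕ → ℝ} {l : ℝ} (h : Tendsto u (hyperfilter ℕ : Filter ℕ) (𝓝 l)) :
    hyperLim u = l := h.limUnder_eq

end HyperLim

namespace LipZero

variable {M N : Type*} [MetricSpace M] [MetricSpace N] {x₀ : M} {y₀ : N}

lemma ext {f g : LipZero M x₀} (h : ∀ x, f x = g x) : f = g := Subtype.ext (funext h)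

lemma map_base (f : LipZero M x₀) : f x₀ = 0 := f.2.1

@[simp]
lemma add_apply (f g : LipZero M x₀) (x : M) : (f + g) x = f x + g x := rfl

@[simp]
lemma smul_apply (c : ℝ) (f : LipZero M x₀) (x : M) : (c • f) x = c * f x := rfl

lemma abs_apply_le (f : LipZero M x₀) (x : M) : |f x| ≤ ‖f‖ * dist x x₀ := by
  simpa [f.map_base] using f.abs_sub_le x x₀

/-- A function with a Lipschitz bound, as an element of `Lip₀(M)`. -/
def ofBound (f : M → ℝ) (h0 : f x₀ = 0) {C : ℝ} (hC : 0 ≤ C)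
    (h : ∀ x y, |f x - f y| ≤ C * dist x y) : LipZero M x₀ :=
  ⟨f, h0, ⟨C, hC⟩, LipschitzWith.of_dist_le_mul h⟩

variable {V : Type*} [NormedAddCommGroup V] [NormedSpace ℝ V]

/-- An operator into `Lip₀(M)` from pointwise linear functionals with Lipschitz bounds. -/
noncomputable def liftCLM (T : V → M → ℝ) (h0 : ∀ v, T v x₀ = 0)
    (hadd : ∀ v w x, T (v + w) x = T v x + T w x) (hsmul : ∀ (c : ℝ) v x, T (c • v) x = c * T v x)
    (C : ℝ) (hC : 0 ≤ C) (h : ∀ v x y, |T v x - T v y| ≤ C * ‖v‖ * dist x y) :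
    V →L[ℝ] LipZero M x₀ :=
  LinearMap.mkContinuous
    { toFun := fun v => ofBound (T v) (h0 v) (mul_nonneg hC (norm_nonneg v)) (h v)
      map_add' := fun v w => ext (hadd v w)
      map_smul' := fun c v => ext (hsmul c v) }
    C fun v => norm_le_of_forall _ (mul_nonneg hC (norm_nonneg v)) (h v)

lemma norm_liftCLM_apply_le (T : V → M → ℝ) (h0 : ∀ v, T v x₀ = 0)
    (hadd : ∀ v w x, T (v + w) x = T v x + T w x) (hsmul : ∀ (c : ℝ) v x, T (c • v) x = c * T v x)
    (C : ℝ) (hC : 0 ≤ C) (h : ∀ v x y, |T v x - T v y| ≤ C * ‖v‖ * dist x y) (v : V) :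
    ‖liftCLM T h0 hadd hsmul C hC h v‖ ≤ C * ‖v‖ :=
  norm_le_of_forall _ (mul_nonneg hC (norm_nonneg v)) (h v)

/-- Composition with a Lipschitz map that preserves the distinguished points, followed by
multiplication by a scalar `c ≥ 0`. -/
noncomputable def compCLM (h : M → N) (h0 : h x₀ = y₀) (c K : ℝ) (hc : 0 ≤ c) (hK : 0 ≤ K)
    (hh : ∀ x y, c * dist (h x) (h y) ≤ K * dist x y) : LipZero N y₀ →L[ℝ] LipZero M x₀ :=
  liftCLM (fun f x => c * f (h x)) (fun f => by rw [h0, f.map_base, mul_zero])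
    (fun f g x => mul_add _ _ _) (fun a f x => mul_left_comm _ _ _) K hK fun f x y => by
      rw [← mul_sub, abs_mul, abs_of_nonneg hc]
      calc c * |f (h x) - f (h y)| ≤ c * (‖f‖ * dist (h x) (h y)) := by
            gcongr
            exact f.abs_sub_le _ _
        _ = ‖f‖ * (c * dist (h x) (h y)) := by ring
        _ ≤ ‖f‖ * (K * dist x y) := mul_le_mul_of_nonneg_left (hh x y) (norm_nonneg f)
        _ = K * ‖f‖ * dist x y := by ring

@[simp]
lemma compCLM_apply (h : M → N) (h0 : h x₀ = y₀) (c K : ℝ) (hc : 0 ≤ c) (hK : 0 ≤ K)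
    (hh : ∀ x y, c * dist (h x) (h y) ≤ K * dist x y) (f : LipZero N y₀) (x : M) :
    compCLM h h0 c K hc hK hh f x = c * f (h x) := rfl

lemma norm_compCLM_apply_le (h : M → N) (h0 : h x₀ = y₀) (c K : ℝ) (hc : 0 ≤ c) (hK : 0 ≤ K)
    (hh : ∀ x y, c * dist (h x) (h y) ≤ K * dist x y) (f : LipZero N y₀) :
    ‖compCLM h h0 c K hc hK hh f‖ ≤ K * ‖f‖ := norm_liftCLM_apply_le ..

/-- If the identity of `M` is the pointwise limit of maps `b n ∘ a n` that factor, uniformly up to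
scaling, through metric spaces `Z n`, then `Lip₀(M)` is complemented in `⨁ Lip₀(Z n)`. -/
theorem isComplementedIn_of_tendsto {Z : ℕ → Type*} [∀ n, MetricSpace (Z n)] {z₀ : ∀ n, Z n}
    (a : ∀ n, M → Z n) (b : ∀ n, Z n → M) (ha0 : ∀ n, a n x₀ = z₀ n) (hb0 : ∀ n, b n (z₀ n) = x₀)
    (c : ℕ → ℝ) (hc : ∀ n, 0 < c n) (K : ℝ) (hK : 0 ≤ K)
    (ha : ∀ n x y, (c n)⁻¹ * dist (a n x) (a n y) ≤ K * dist x y)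
    (hb : ∀ n x y, c n * dist (b n x) (b n y) ≤ K * dist x y)
    (hlim : ∀ x, Filter.Tendsto (fun n => b n (a n x)) Filter.atTop (nhds x)) :
    IsComplementedIn (LipZero M x₀) (lp (fun n => LipZero (Z n) (z₀ n)) ∞) := by
  -- The factors `c n` and `(c n)⁻¹` compensate the Lipschitz constants of `b n` and `a n`, making
  -- both families uniformly bounded; they cancel in the composition.
  let A : ∀ n, LipZero (Z n) (z₀ n) →L[ℝ] LipZero M x₀ := fun n =>
    compCLM (a n) (ha0 n) (c n)⁻¹ K (inv_nonneg.2 (hc n).le) hK (ha n)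
  let B : ∀ n, LipZero M x₀ →L[ℝ] LipZero (Z n) (z₀ n) := fun n =>
    compCLM (b n) (hb0 n) (c n) K (hc n).le hK (hb n)
  have hA : ∀ (g : lp (fun n => LipZero (Z n) (z₀ n)) ∞) n, ‖A n (g n)‖ ≤ K * ‖g‖ := fun g n =>
    (norm_compCLM_apply_le ..).trans (mul_le_mul_of_nonneg_left (norm_lpInfty_apply_le g n) hK)
  have hT : ∀ (g : lp (fun n => LipZero (Z n) (z₀ n)) ∞) (x : M),
      Filter.Tendsto (fun n => A n (g n) x) (Filter.hyperfilter ℕ)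
        (nhds (hyperLim fun n => A n (g n) x)) := fun g x =>
    tendsto_hyperLim (C := K * ‖g‖ * dist x x₀) fun n => ((A n (g n)).abs_apply_le x).trans
      (mul_le_mul_of_nonneg_right (hA g n) dist_nonneg)
  refine ⟨lpInftyLift B K hK fun n f => norm_compCLM_apply_le .., liftCLM
    (fun g x => hyperLim fun n => A n (g n) x) (fun g => ?_) (fun f g x => ?_) (fun r f x => ?_)
    K hK (fun g x y => ?_), fun f => ext fun x => ?_⟩
  · refine hyperLim_eq (tendsto_const_nhds.congr fun n => ?_)
    rw [(A n (g n)).map_base]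
  · exact hyperLim_eq (((hT f x).add (hT g x)).congr fun n => by simp)
  · exact hyperLim_eq (((hT f x).const_mul r).congr fun n => by simp)
  · refine le_of_tendsto ((hT g x).sub (hT g y)).abs (Filter.Eventually.of_forall fun n => ?_)
    exact ((A n (g n)).abs_sub_le x y).trans (mul_le_mul_of_nonneg_right (hA g n) dist_nonneg)
  -- The free ultrafilter refines `atTop`, so here the limit is the ordinary limit of `f (b n (a n
  -- x))`, which is `f x` by continuity.
  · refine hyperLim_eq ?_
    have hf : Continuous f := by
      obtain ⟨-, L, hL⟩ := f.2
      exact hL.continuous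
    refine (((hf.tendsto x).comp (hlim x)).mono_left Nat.hyperfilter_le_atTop).congr
      fun n => ?_
    simp only [A, B, lpInftyLift_apply, compCLM_apply, Function.comp_apply]
    rw [inv_mul_cancel_left₀ (hc n).ne']

/-- If each `Z n` is a Lipschitz retract of `N n`, uniformly in `n`, then `⨁ Lip₀(Z n)` is
complemented in `⨁ Lip₀(N n)`. -/
theorem isComplementedIn_sum {Z N : ℕ → Type*} [∀ n, MetricSpace (Z n)] [∀ n, MetricSpace (N n)]
    {z₀ : ∀ n, Z n} {y₀ : ∀ n, N n} (i : ∀ n, Z n → N n) (P : ∀ n, N n → Z n)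
    (hi0 : ∀ n, i n (z₀ n) = y₀ n) (hP0 : ∀ n, P n (y₀ n) = z₀ n) (K : ℝ) (hK : 0 ≤ K)
    (hi : ∀ n x y, dist (i n x) (i n y) ≤ K * dist x y)
    (hP : ∀ n x y, dist (P n x) (P n y) ≤ K * dist x y) (h : ∀ n x, P n (i n x) = x) :
    IsComplementedIn (lp (fun n => LipZero (Z n) (z₀ n)) ∞)
      (lp (fun n => LipZero (N n) (y₀ n)) ∞) := by
  refine ⟨lpInftyMap (fun n => compCLM (P n) (hP0 n) 1 K zero_le_one hK
      (by simpa using hP n)) K hK fun n => norm_compCLM_apply_le _ _ _ _ _ _ _,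
    lpInftyMap (fun n => compCLM (i n) (hi0 n) 1 K zero_le_one hK
      (by simpa using hi n)) K hK fun n => norm_compCLM_apply_le _ _ _ _ _ _ _, fun g => ?_⟩
  ext n
  refine ext fun x => ?_
  simp [h]

/-- A Lipschitz retract of `N` has a complemented space of Lipschitz functions. -/
theorem isComplementedIn_of_retract (i : M → N) (P : N → M) (hi0 : i x₀ = y₀) (hP0 : P y₀ = x₀)
    (K : ℝ) (hK : 0 ≤ K) (hi : ∀ x y, dist (i x) (i y) ≤ K * dist x y)
    (hP : ∀ x y, dist (P x) (P y) ≤ K * dist x y) (h : ∀ x, P (i x) = x) :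
    IsComplementedIn (LipZero M x₀) (LipZero N y₀) :=
  ⟨compCLM P hP0 1 K zero_le_one hK (by simpa using hP),
    compCLM i hi0 1 K zero_le_one hK (by simpa using hi), fun f => ext fun x => by simp [h]⟩

end LipZero

/-! ### `Lip₀` of a normed space is isomorphic to its `ℓ_∞`-sum -/

section Ball

variable (X : Type*) [NormedAddCommGroup X] [NormedSpace ℝ X]

/-- The closed unit ball of a normed space. -/
abbrev UnitBall : Type _ := Metric.closedBall (0 : X) 1

/-- The centre of the unit ball. -/
def UnitBall.center : UnitBall X := ⟨0, Metric.mem_closedBall_self zero_le_one⟩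

variable {X}

/-- The radial retraction onto the closed unit ball. -/
noncomputable def radial (x : X) : UnitBall X :=
  ⟨(max 1 ‖x‖)⁻¹ • x, by
    rw [mem_closedBall_zero_iff, norm_smul, norm_inv, Real.norm_eq_abs,
      abs_of_pos (zero_lt_one.trans_le (le_max_left _ _)),
      inv_mul_le_iff₀ (zero_lt_one.trans_le (le_max_left _ _)), mul_one]
    exact le_max_right _ _⟩

lemma coe_radial_of_norm_le {x : X} (hx : ‖x‖ ≤ 1) : (radial x : X) = x := by
  simp [radial, max_eq_left hx]

lemma radial_coe (x : UnitBall X) : radial (x : X) = x :=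
  Subtype.ext (coe_radial_of_norm_le (mem_closedBall_zero_iff.1 x.2))

lemma radial_zero : radial (0 : X) = UnitBall.center X := radial_coe (UnitBall.center X)

/-- With `m = max 1 ‖x‖` and `n = max 1 ‖y‖`, write `m⁻¹x - n⁻¹y = m⁻¹(x - y) + (m⁻¹ - n⁻¹)y`. Since
`m ≥ 1`, `‖y‖ ≤ n` and `|n - m| ≤ ‖x - y‖`, each term has norm at most `‖x - y‖`, whence the
constant 2. -/
lemma dist_radial_le (x y : X) : dist (radial x) (radial y) ≤ 2 * dist x y := by
  change dist ((max 1 ‖x‖)⁻¹ • x) ((max 1 ‖y‖)⁻¹ • y) ≤ _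
  have hm : 1 ≤ max 1 ‖x‖ := le_max_left _ _
  have hn : 1 ≤ max 1 ‖y‖ := le_max_left _ _
  have hy : ‖y‖ ≤ max 1 ‖y‖ := le_max_right _ _
  have hmn : |max 1 ‖y‖ - max 1 ‖x‖| ≤ ‖x - y‖ := by
    refine (abs_max_sub_max_le_max 1 ‖y‖ 1 ‖x‖).trans ?_
    rw [sub_self, abs_zero, norm_sub_rev]
    exact max_le (norm_nonneg _) (abs_norm_sub_norm_le _ _)
  generalize max 1 ‖x‖ = m at *
  generalize max 1 ‖y‖ = n at *
  have hm0 : 0 < m := by linarith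
  have hn0 : 0 < n := by linarith
  have e : m⁻¹ • x - n⁻¹ • y = m⁻¹ • (x - y) + (m⁻¹ * (n - m) * n⁻¹) • y := by
    have : m⁻¹ * (n - m) * n⁻¹ = m⁻¹ - n⁻¹ := by field_simp
    rw [this, smul_sub, sub_smul]
    abel
  rw [dist_eq_norm, dist_eq_norm, e, two_mul]
  refine (norm_add_le _ _).trans (add_le_add ?_ ?_)
  · rw [norm_smul, norm_inv, Real.norm_eq_abs, abs_of_pos hm0, inv_mul_le_iff₀ hm0]
    exact le_mul_of_one_le_left (norm_nonneg _) hm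
  · rw [norm_smul, Real.norm_eq_abs, abs_mul, abs_mul, abs_inv, abs_inv, abs_of_pos hm0,
      abs_of_pos hn0]
    calc m⁻¹ * |n - m| * n⁻¹ * ‖y‖ ≤ 1 * ‖x - y‖ * n⁻¹ * n := by
          gcongr
          exact inv_le_one_of_one_le₀ hm
      _ = ‖x - y‖ := by field_simp

end Ball

namespace LipZero

/-! ### Extending functions from the unit ball with bounded support. -/

section Bump

variable {X : Type*} [NormedAddCommGroup X] [NormedSpace ℝ X]

/-- The extension of a Lipschitz function on the unit ball to a function supported in the ball of
radius `2`. -/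
noncomputable def bump (f : LipZero (UnitBall X) (UnitBall.center X)) (x : X) : ℝ :=
  f (radial x) * max 0 (2 - max 1 ‖x‖)

lemma bump_coe (f : LipZero (UnitBall X) (UnitBall.center X)) (x : UnitBall X) :
    bump f x = f x := by
  have hx : ‖(x : X)‖ ≤ 1 := mem_closedBall_zero_iff.1 x.2
  rw [bump, radial_coe, max_eq_left hx]
  norm_num

lemma bump_eq_zero (f : LipZero (UnitBall X) (UnitBall.center X)) {x : X} (hx : 2 ≤ ‖x‖) :
    bump f x = 0 := by
  rw [bump, max_eq_left, mul_zero]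
  linarith [le_max_right 1 ‖x‖]

/-- Product rule: `f ∘ radial` is `2‖f‖`-Lipschitz and bounded by `‖f‖`, while the cutoff is
1-Lipschitz and bounded by 1, so `3 = 2 + 1`. -/
lemma abs_bump_sub_le (f : LipZero (UnitBall X) (UnitBall.center X)) (x y : X) :
    |bump f x - bump f y| ≤ 3 * ‖f‖ * dist x y := by
  have hm : |max 0 (2 - max 1 ‖x‖) - max 0 (2 - max 1 ‖y‖)| ≤ dist x y := by
    refine (abs_max_sub_max_le_max _ _ _ _).trans ?_
    rw [sub_self, abs_zero, sub_sub_sub_cancel_left]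
    refine max_le dist_nonneg ((abs_max_sub_max_le_max _ _ _ _).trans ?_)
    rw [sub_self, abs_zero, dist_comm, dist_eq_norm]
    exact max_le (norm_nonneg _) (abs_norm_sub_norm_le _ _)
  have h1 : |max 0 (2 - max 1 ‖y‖)| ≤ 1 := by
    rw [abs_of_nonneg (le_max_left _ _)]
    exact max_le zero_le_one (by linarith [le_max_left 1 ‖y‖])
  have h2 : |f (radial x)| ≤ ‖f‖ := by
    refine (f.abs_apply_le _).trans (mul_le_of_le_one_right (norm_nonneg f) ?_)
    exact (radial x).2
  have h3 : |f (radial x) - f (radial y)| ≤ 2 * ‖f‖ * dist x y := by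
    calc _ ≤ ‖f‖ * dist (radial x) (radial y) := f.abs_sub_le _ _
      _ ≤ ‖f‖ * (2 * dist x y) := mul_le_mul_of_nonneg_left (dist_radial_le x y) (norm_nonneg f)
      _ = 2 * ‖f‖ * dist x y := by ring
  rw [bump, bump]
  generalize max 0 (2 - max 1 ‖x‖) = s at *
  generalize max 0 (2 - max 1 ‖y‖) = t at *
  have e : f (radial x) * s - f (radial y) * t
      = f (radial x) * (s - t) + (f (radial x) - f (radial y)) * t := by ring
  rw [e]
  refine (abs_add_le _ _).trans ?_
  rw [abs_mul, abs_mul]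
  calc _ ≤ ‖f‖ * dist x y + 2 * ‖f‖ * dist x y * 1 := by
        gcongr
    _ = 3 * ‖f‖ * dist x y := by ring

end Bump

/-! ### Kaufmann's theorem: `Lip₀(X)`, the unit ball and `ℓ_∞`-sums. -/

section Kaufmann

variable (X : Type*) [NormedAddCommGroup X] [NormedSpace ℝ X]

/-- Retract `X` radially onto the ball of radius `n + 1`, viewed as a dilated unit ball. The
retractions fix `x` as soon as `‖x‖ ≤ n + 1`, and the scalars `c n = (n + 1)⁻¹` absorb the
dilations. -/
lemma isComplementedIn_sum_unitBall : IsComplementedIn (LipZero X 0)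
    (lp (fun _ : ℕ => LipZero (UnitBall X) (UnitBall.center X)) ∞) := by
  have hpos : ∀ n : ℕ, (0 : ℝ) < n + 1 := fun n => by positivity
  refine isComplementedIn_of_tendsto (fun n x => radial (((n : ℝ) + 1)⁻¹ • x))
    (fun n y => ((n : ℝ) + 1) • (y : X)) (fun n => by rw [smul_zero, radial_zero])
    (fun n => smul_zero _) (fun n => ((n : ℝ) + 1)⁻¹) (fun n => inv_pos.2 (hpos n)) 2 zero_le_two
    (fun n x y => ?_) (fun n x y => ?_) fun x => ?_
  · rw [inv_inv]
    calc ((n : ℝ) + 1) * dist (radial _) (radial _)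
        ≤ ((n : ℝ) + 1) * (2 * dist (((n : ℝ) + 1)⁻¹ • x) (((n : ℝ) + 1)⁻¹ • y)) :=
          mul_le_mul_of_nonneg_left (dist_radial_le _ _) (hpos n).le
      _ = 2 * dist x y := by
          rw [dist_smul₀, norm_inv, Real.norm_eq_abs, abs_of_pos (hpos n)]
          have := (hpos n).ne'
          field_simp
  · rw [dist_smul₀, Real.norm_eq_abs, abs_of_pos (hpos n), inv_mul_cancel_left₀ (hpos n).ne']
    exact le_mul_of_one_le_left dist_nonneg one_le_two
  · refine tendsto_const_nhds.congr' ?_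
    filter_upwards [Filter.eventually_ge_atTop ⌈‖x‖⌉₊] with n hn
    have hx : ‖x‖ ≤ n + 1 := (Nat.ceil_le.1 hn).trans (by linarith)
    rw [coe_radial_of_norm_le, smul_inv_smul₀ (hpos n).ne']
    rwa [norm_smul, norm_inv, Real.norm_eq_abs, abs_of_pos (hpos n), inv_mul_le_iff₀ (hpos n),
      mul_one]

/-- Place the `k`-th function on a unit ball around `c k`, the centres being so far apart that the
bumps have disjoint supports. Restriction to these balls undoes the construction. -/
lemma sum_unitBall_isComplementedIn :
    IsComplementedIn (lp (fun _ : ℕ => LipZero (UnitBall X) (UnitBall.center X)) ∞)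
      (LipZero X 0) := by
  classical
  rcases subsingleton_or_nontrivial X with hX | hX
  -- There is no unit vector in the zero space, but there `Lip₀` of the ball vanishes too.
  · refine ⟨0, 0, fun F => ?_⟩
    ext k
    refine ext fun y => ?_
    rw [Subsingleton.elim y (UnitBall.center X), map_base, map_base]
  obtain ⟨v, hv⟩ := exists_norm_eq X zero_le_one
  -- Spacing 5 exceeds 4, so the balls of radius 2 carrying the bumps are disjoint; starting at `5v`
  -- keeps the origin outside them all.
  let c : ℕ → X := fun k => (5 * ((k : ℝ) + 1)) • v
  have hc : ∀ j k, j ≠ k → 5 ≤ ‖c j - c k‖ := fun j k hjk => by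
    rw [← sub_smul, norm_smul, hv, mul_one, Real.norm_eq_abs, ← mul_sub, abs_mul,
      add_sub_add_right_eq_sub]
    have : (1 : ℝ) ≤ |(j : ℝ) - k| := by
      have h : (1 : ℤ) ≤ |(j : ℤ) - k| := Int.one_le_abs (sub_ne_zero.2 (by exact_mod_cast hjk))
      exact_mod_cast h
    norm_num
    linarith
  have hc0 : ∀ k, 5 ≤ ‖c k‖ := fun k => by
    rw [norm_smul, hv, mul_one, Real.norm_eq_abs, abs_of_pos (by positivity)]
    have : (0 : ℝ) ≤ k := k.cast_nonneg
    linarith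
  -- The only ball containing `x` has index `κ x`. Outside all of them the default 0 is harmless, as
  -- the bump around `c 0` vanishes there as well.
  let κ : X → ℕ := fun x => if h : ∃ k, ‖x - c k‖ < 2 then h.choose else 0
  have hκ : ∀ x k, ‖x - c k‖ < 2 → κ x = k := fun x k hk => by
    have h : ∃ k, ‖x - c k‖ < 2 := ⟨k, hk⟩
    have e : κ x = h.choose := dif_pos h
    by_contra hne
    have h1 := hc _ _ hne
    have h2 : ‖x - c (κ x)‖ < 2 := e ▸ h.choose_spec
    have h3 : c (κ x) - c k = (x - c k) - (x - c (κ x)) := by abel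
    rw [h3] at h1
    linarith [norm_sub_le (x - c k) (x - c (κ x))]
  have hdist : ∀ k (y : UnitBall X), ‖c k + y - c k‖ < 2 := fun k y => by
    rw [add_sub_cancel_left]
    exact (mem_closedBall_zero_iff.1 y.2).trans_lt one_lt_two
  let S : lp (fun _ : ℕ => LipZero (UnitBall X) (UnitBall.center X)) ∞ →L[ℝ] LipZero X 0 :=
    liftCLM (fun F x => bump (F (κ x)) (x - c (κ x)))
      (fun F => bump_eq_zero _ (by rw [zero_sub, norm_neg]; linarith [hc0 (κ 0)]))
      (fun F G x => by
        simp only [bump, lp.coeFn_add, Pi.add_apply, add_apply]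
        ring)
      (fun r F x => by
        simp only [bump, lp.coeFn_smul, Pi.smul_apply, smul_apply]
        ring) 6 (by norm_num) fun F x y => by
        have hF : ∀ k, |bump (F k) (x - c k) - bump (F k) (y - c k)| ≤ 3 * ‖F‖ * dist x y :=
          fun k => by
            refine (abs_bump_sub_le _ _ _).trans ?_
            rw [dist_sub_right]
            gcongr
            exact norm_lpInfty_apply_le F k
        have hnn : 0 ≤ 3 * ‖F‖ * dist x y := by positivity
        -- If the indices differ, each bump vanishes at the other point, so each value is at most
        -- `3‖F‖ dist x y`; their sum gives the constant 6.
        rcases eq_or_ne (κ x) (κ y) with h | h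
        · rw [h]
          exact (hF _).trans (by linarith)
        · have h1 : bump (F (κ y)) (x - c (κ y)) = 0 :=
            bump_eq_zero _ (not_lt.1 fun h' => h (hκ x _ h'))
          have h2 : bump (F (κ x)) (y - c (κ x)) = 0 :=
            bump_eq_zero _ (not_lt.1 fun h' => h (hκ y _ h').symm)
          have e1 := hF (κ x)
          have e2 := hF (κ y)
          rw [h2, sub_zero] at e1
          rw [h1, zero_sub, abs_neg] at e2
          exact (abs_sub _ _).trans (by linarith)
  -- Subtracting the value at `c k` restores the normalization at the centre of the ball.
  let T : ∀ _ : ℕ, LipZero X 0 →L[ℝ] LipZero (UnitBall X) (UnitBall.center X) := fun k =>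
    liftCLM (fun f y => f (c k + y) - f (c k)) (fun f => by simp [UnitBall.center])
      (fun f g y => by simp only [add_apply]; ring)
      (fun r f y => by simp only [smul_apply]; ring) 1 zero_le_one fun f x y => by
        rw [sub_sub_sub_cancel_right, one_mul]
        refine (f.abs_sub_le _ _).trans (le_of_eq ?_)
        rw [dist_add_left]
        rfl
  refine ⟨S, lpInftyLift T 1 zero_le_one fun k f => norm_liftCLM_apply_le .., fun F => ?_⟩
  ext k
  refine ext fun y => ?_
  have h1 : κ (c k + y) = k := hκ _ _ (hdist k y)
  have h2 : κ (c k) = k := hκ _ _ (by simp)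
  have h3 : bump (F k) 0 = 0 := by
    have := bump_coe (F k) (UnitBall.center X)
    rwa [map_base] at this
  change bump (F (κ (c k + y))) (c k + y - c (κ (c k + y)))
    - bump (F (κ (c k))) (c k - c (κ (c k))) = F k y
  rw [h1, h2, add_sub_cancel_left, sub_self, h3, bump_coe, sub_zero]

/-- `Lip₀(X)` is isomorphic to its own `ℓ_∞`-sum. -/
theorem nonempty_equiv_lpInfty :
    Nonempty (LipZero X 0 ≃L[ℝ] lp (fun _ : ℕ => LipZero X 0) ∞) := by
  -- An `ℓ_∞`-sum of a constant family is isomorphic to its own `ℓ_∞`-sum via a bijection of `ℕ × ℕ`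
  -- with `ℕ`.
  obtain ⟨e⟩ := (isComplementedIn_sum_unitBall X).nonempty_equiv (sum_unitBall_isComplementedIn X)
    (lpInftyIterate _).symm
  exact ⟨(e.trans (lpInftyIterate _).symm).trans (lpInftyCongr e.symm)⟩

end Kaufmann

/-! ### The decomposition method for uniformly bounded linear approximations. -/

section Linear

variable {X : Type*} [NormedAddCommGroup X] [NormedSpace ℝ X]

lemma dist_map_le_of_norm_le {Y : Type*} [NormedAddCommGroup Y] [NormedSpace ℝ Y]
    {T : X →ₗ[ℝ] Y} {K : ℝ} (hT : ∀ x, ‖T x‖ ≤ K * ‖x‖) (x y : X) :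
    dist (T x) (T y) ≤ K * dist x y := by
  rw [dist_eq_norm, dist_eq_norm, ← map_sub]
  exact hT _

lemma isComplementedIn_of_tendsto_linear {Z : ℕ → Type*} [∀ n, NormedAddCommGroup (Z n)]
    [∀ n, NormedSpace ℝ (Z n)] (a : ∀ n, X →ₗ[ℝ] Z n) (b : ∀ n, Z n →ₗ[ℝ] X) (K : ℝ) (hK : 0 ≤ K)
    (ha : ∀ n x, ‖a n x‖ ≤ K * ‖x‖) (hb : ∀ n x, ‖b n x‖ ≤ K * ‖x‖)
    (hlim : ∀ x, Filter.Tendsto (fun n => b n (a n x)) Filter.atTop (nhds x)) :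
    IsComplementedIn (LipZero X 0) (lp (fun n => LipZero (Z n) 0) ∞) :=
  isComplementedIn_of_tendsto (fun n => a n) (fun n => b n) (fun n => map_zero _)
    (fun n => map_zero _) (fun _ => 1) (fun _ => one_pos) K hK
    (fun n => by simpa using dist_map_le_of_norm_le (ha n))
    (fun n => by simpa using dist_map_le_of_norm_le (hb n)) hlim

/-- If the identity of `X` is the pointwise limit of uniformly bounded projections onto copies of
the spaces `Z n`, then `Lip₀(X) ≃ ⨁ Lip₀(Z n)`. -/
theorem nonempty_equiv_sum {Z : ℕ → Type*} [∀ n, NormedAddCommGroup (Z n)]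
    [∀ n, NormedSpace ℝ (Z n)] (a : ∀ n, X →ₗ[ℝ] Z n) (b : ∀ n, Z n →ₗ[ℝ] X) (K : ℝ) (hK : 0 ≤ K)
    (ha : ∀ n x, ‖a n x‖ ≤ K * ‖x‖) (hb : ∀ n x, ‖b n x‖ ≤ K * ‖x‖)
    (hlim : ∀ x, Filter.Tendsto (fun n => b n (a n x)) Filter.atTop (nhds x))
    (hab : ∀ n x, a n (b n x) = x) :
    Nonempty (LipZero X 0 ≃L[ℝ] lp (fun n => LipZero (Z n) 0) ∞) := by
  obtain ⟨e⟩ := nonempty_equiv_lpInfty X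
  -- Each `Z n` is a retract of `X`, so the sum sits in `ℓ_∞(Lip₀(X))`, which is `Lip₀(X)` again.
  have h : IsComplementedIn (lp (fun n => LipZero (Z n) 0) ∞) (lp (fun _ : ℕ => LipZero X 0) ∞) :=
    isComplementedIn_sum (fun n => b n) (fun n => a n) (fun n => map_zero _)
      (fun n => map_zero _) K hK (fun n => dist_map_le_of_norm_le (hb n))
      (fun n => dist_map_le_of_norm_le (ha n)) hab
  obtain ⟨e'⟩ := (h.trans e.symm.isComplementedIn).nonempty_equiv
    (isComplementedIn_of_tendsto_linear a b K hK ha hb hlim) e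
  exact ⟨e'.symm⟩

/-- If `Z` is complemented in `X` and the identity of `X` is the pointwise limit of uniformly
bounded operators that factor uniformly through `Z`, then `Lip₀(X) ≃ Lip₀(Z)`. -/
theorem nonempty_equiv_of_factor {Z : Type*} [NormedAddCommGroup Z] [NormedSpace ℝ Z]
    (a : ℕ → X →ₗ[ℝ] Z) (b : ℕ → Z →ₗ[ℝ] X) (K : ℝ) (hK : 0 ≤ K)
    (ha : ∀ n x, ‖a n x‖ ≤ K * ‖x‖) (hb : ∀ n x, ‖b n x‖ ≤ K * ‖x‖)
    (hlim : ∀ x, Filter.Tendsto (fun n => b n (a n x)) Filter.atTop (nhds x))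
    (P : X →ₗ[ℝ] Z) (i : Z →ₗ[ℝ] X) (hP : ∀ x, ‖P x‖ ≤ K * ‖x‖) (hi : ∀ x, ‖i x‖ ≤ K * ‖x‖)
    (hPi : ∀ x, P (i x) = x) : Nonempty (LipZero X 0 ≃L[ℝ] LipZero Z 0) := by
  obtain ⟨e⟩ := nonempty_equiv_lpInfty Z
  -- The approximations put `Lip₀(X)` into `ℓ_∞(Lip₀(Z)) ≃ Lip₀(Z)`; the retraction gives the other
  -- direction.
  exact ((isComplementedIn_of_tendsto_linear a b K hK ha hb hlim).trans
    e.symm.isComplementedIn).nonempty_equiv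
    (isComplementedIn_of_retract i P (map_zero _) (map_zero _) K hK (dist_map_le_of_norm_le hi)
      (dist_map_le_of_norm_le hP) hPi) e

end Linear

end LipZero

/-! ### Operators between Orlicz spaces -/

namespace YoungFunctionDelta2

variable (Φ : YoungFunctionDelta2)

lemma pos_of_pos {x : ℝ≥0} (hx : 0 < x) : 0 < Φ x := by
  rw [← Φ.map_zero]
  exact Φ.strictMono' hx

/-- The even extension of `Φ` is a finite convex function on all of `ℝ`; this makes Jensen's
inequality applicable and yields continuity, including at 0. -/
lemma convexOn_nnnorm : ConvexOn ℝ Set.univ fun x : ℝ => (Φ ‖x‖₊ : ℝ) := by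
  refine ⟨convex_univ, fun x _ y _ a b ha hb hab => ?_⟩
  lift a to ℝ≥0 using ha
  lift b to ℝ≥0 using hb
  have hab' : a + b = 1 := by exact_mod_cast hab
  have h : Φ ‖(a : ℝ) • x + (b : ℝ) • y‖₊ ≤ a * Φ ‖x‖₊ + b * Φ ‖y‖₊ := by
    refine (Φ.mono ?_).trans (Φ.convex hab' _ _)
    refine (nnnorm_add_le _ _).trans (le_of_eq ?_)
    rw [nnnorm_smul, nnnorm_smul, NNReal.nnnorm_eq, NNReal.nnnorm_eq]
  exact_mod_cast h

lemma continuous_nnnorm : Continuous fun x : ℝ => (Φ ‖x‖₊ : ℝ) :=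
  continuousOn_univ.1 (Φ.convexOn_nnnorm.continuousOn isOpen_univ)

lemma continuous : Continuous Φ := by
  have h : Continuous fun x : ℝ≥0 => (Φ ‖(x : ℝ)‖₊ : ℝ) :=
    Φ.continuous_nnnorm.comp NNReal.continuous_coe
  refine (continuous_real_toNNReal.comp h).congr fun x => ?_
  simp

/-- Convexity and `Φ 0 = 0` give `x Φ(1) ≤ Φ(x)` for `x ≥ 1`. This linear growth makes Orlicz
functions integrable on sets of finite measure. -/
lemma le_one_add (x : ℝ≥0) : x ≤ 1 + (Φ 1)⁻¹ * Φ x := by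
  have h1 : 0 < Φ 1 := Φ.pos_of_pos one_pos
  rcases le_total x 1 with hx | hx
  · exact hx.trans le_self_add
  · have hx0 : 0 < x := one_pos.trans_le hx
    have h := Φ.map_mul_le (inv_le_one_of_one_le₀ hx) x
    rw [inv_mul_cancel₀ hx0.ne', le_inv_mul_iff₀ hx0] at h
    refine le_trans ?_ le_add_self
    rwa [le_inv_mul_iff₀ h1, mul_comm]

end YoungFunctionDelta2

section Jensen

variable {Ω : Type*} [MeasurableSpace Ω] {μ : Measure Ω} (Φ : YoungFunctionDelta2)

/-- Jensen's inequality, multiplied by `μ S` so that null sets and infinite right-hand sides are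
covered and the fibres can be summed. -/
lemma YoungFunctionDelta2.map_setAverage_mul_le {g : Ω → ℝ} {S : Set Ω} (hS : μ S ≠ ∞)
    (hg : IntegrableOn g S μ) :
    (Φ ‖⨍ x in S, g x ∂μ‖₊ : ℝ≥0∞) * μ S ≤ ∫⁻ x in S, (Φ ‖g x‖₊ : ℝ≥0∞) ∂μ := by
  rcases eq_or_ne (μ S) 0 with h0 | h0
  · simp [h0]
  rcases eq_or_ne (∫⁻ x in S, (Φ ‖g x‖₊ : ℝ≥0∞) ∂μ) ∞ with htop | htop
  · simp [htop]
  have hint : IntegrableOn (fun x => (Φ ‖g x‖₊ : ℝ)) S μ := by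
    refine ⟨Φ.continuous_nnnorm.comp_aestronglyMeasurable hg.1, ?_⟩
    rw [hasFiniteIntegral_iff_enorm]
    refine lt_of_eq_of_lt (lintegral_congr fun x => ?_) htop.lt_top
    simp [enorm_eq_nnnorm]
  have hJ := Φ.convexOn_nnnorm.map_set_average_le Φ.continuous_nnnorm.continuousOn isClosed_univ
    h0 hS (by simp) hg hint
  have he : ∫⁻ x in S, (Φ ‖g x‖₊ : ℝ≥0∞) ∂μ
      = ENNReal.ofReal (∫ x in S, (Φ ‖g x‖₊ : ℝ) ∂μ) := by
    rw [ofReal_integral_eq_lintegral_ofReal hint (Filter.Eventually.of_forall fun x => by simp)]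
    simp
  have hJ' : (Φ ‖⨍ x in S, g x ∂μ‖₊ : ℝ) * μ.real S ≤ ∫ x in S, (Φ ‖g x‖₊ : ℝ) ∂μ := by
    rw [setAverage_eq (f := fun x => (Φ ‖g x‖₊ : ℝ)), smul_eq_mul] at hJ
    have hpos : 0 < μ.real S := ENNReal.toReal_pos h0 hS
    rwa [le_inv_mul_iff₀ hpos, mul_comm] at hJ
  rw [he]
  refine le_trans (le_of_eq ?_) (ENNReal.ofReal_le_ofReal hJ')
  rw [ENNReal.ofReal_mul (NNReal.coe_nonneg _), ENNReal.ofReal_coe_nnreal, ofReal_measureReal hS]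

end Jensen

section NatMk

variable (ν : Measure ℕ)

/-- The class of a sequence modulo almost everywhere equality. -/
noncomputable def natMk (u : ℕ → ℝ) : ℕ →ₘ[ν] ℝ :=
  AEEqFun.mk u (measurable_of_countable u).aestronglyMeasurable

lemma coeFn_natMk (u : ℕ → ℝ) : ∀ᵐ k ∂ν, natMk ν u k = u k := AEEqFun.coeFn_mk _ _

lemma natMk_add (u v : ℕ → ℝ) : natMk ν (fun k => u k + v k) = natMk ν u + natMk ν v := by
  refine AEEqFun.ext ?_
  filter_upwards [coeFn_natMk ν fun k => u k + v k, coeFn_natMk ν u, coeFn_natMk ν v,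
    AEEqFun.coeFn_add (natMk ν u) (natMk ν v)] with k h1 h2 h3 h4
  rw [h1, h4, Pi.add_apply, h2, h3]

lemma natMk_smul (c : ℝ) (u : ℕ → ℝ) : natMk ν (fun k => c * u k) = c • natMk ν u := by
  refine AEEqFun.ext ?_
  filter_upwards [coeFn_natMk ν fun k => c * u k, coeFn_natMk ν u,
    AEEqFun.coeFn_smul c (natMk ν u)] with k h1 h2 h3
  rw [h1, h3, Pi.smul_apply, h2, smul_eq_mul]

end NatMk

namespace OrliczSpace

variable {Ω Ω' : Type*} [MeasurableSpace Ω] [MeasurableSpace Ω'] {Φ Ψ : YoungFunctionDelta2}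
  {μ : Measure Ω} {μ' : Measure Ω'}

lemma ext {f g : OrliczSpace Φ μ} (h : ∀ᵐ x ∂μ, f x = g x) : f = g :=
  Subtype.ext (AEEqFun.ext h)

lemma coeFn_add (f g : OrliczSpace Φ μ) : ∀ᵐ x ∂μ, (f + g) x = f x + g x :=
  AEEqFun.coeFn_add f.1 g.1

lemma coeFn_sub (f g : OrliczSpace Φ μ) : ∀ᵐ x ∂μ, (f - g) x = f x - g x :=
  AEEqFun.coeFn_sub f.1 g.1

lemma coeFn_smul (c : ℝ) (f : OrliczSpace Φ μ) : ∀ᵐ x ∂μ, (c • f) x = c * f x :=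
  AEEqFun.coeFn_smul c f.1

lemma measurable (f : OrliczSpace Φ μ) : Measurable f := f.1.measurable

lemma lintegral_lt_top (f : OrliczSpace Φ μ) : ∫⁻ x, (Φ ‖f x‖₊ : ℝ≥0∞) ∂μ < ∞ := f.2

lemma norm_le_of_mem {f : OrliczSpace Φ μ} {r : ℝ≥0} (h : r ∈ gaugeSet f) : ‖f‖ ≤ r := by
  rw [norm_def, NNReal.coe_le_coe]
  exact csInf_le (OrderBot.bddBelow _) h

/-- Comparing modulars at every scale `r` gives an inclusion of the gauge sets. -/
lemma norm_le_norm_of_lintegral_le {f : OrliczSpace Φ μ} {g : OrliczSpace Ψ μ'}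
    (h : ∀ r : ℝ≥0, 0 < r →
      ∫⁻ x, (Ψ (‖g x‖₊ / r) : ℝ≥0∞) ∂μ' ≤ ∫⁻ x, (Φ (‖f x‖₊ / r) : ℝ≥0∞) ∂μ) : ‖g‖ ≤ ‖f‖ := by
  rw [norm_def, norm_def, NNReal.coe_le_coe]
  exact csInf_le_csInf (OrderBot.bddBelow _) (gaugeSet_nonempty f)
    fun r hr => ⟨hr.1, (h r hr.1).trans hr.2⟩

lemma integrableOn (f : OrliczSpace Φ μ) {S : Set Ω} (hS : μ S ≠ ∞) : IntegrableOn f S μ := by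
  refine ⟨f.measurable.aestronglyMeasurable, ?_⟩
  rw [hasFiniteIntegral_iff_enorm]
  have hle : ∀ x, ‖f x‖ₑ ≤ 1 + ((Φ 1)⁻¹ : ℝ≥0) * (Φ ‖f x‖₊ : ℝ≥0∞) := fun x => by
    rw [enorm_eq_nnnorm]
    exact_mod_cast Φ.le_one_add ‖f x‖₊
  refine (lintegral_mono hle).trans_lt ?_
  rw [lintegral_add_left measurable_const, lintegral_const_mul' _ _ ENNReal.coe_ne_top,
    lintegral_const, one_mul, Measure.restrict_apply_univ]
  exact ENNReal.add_lt_top.2 ⟨hS.lt_top, ENNReal.mul_lt_top ENNReal.coe_lt_top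
    ((setLIntegral_le_lintegral _ _).trans_lt f.2)⟩

/-! ### Composition operators between Orlicz spaces. -/

section Comp

variable (π : Ω' → Ω) (hπ : Measure.QuasiMeasurePreserving π μ' μ)
  (h : ∀ f : Ω → ℝ≥0, Measurable f →
    ∫⁻ x, (Ψ (f (π x)) : ℝ≥0∞) ∂μ' ≤ ∫⁻ x, (Φ (f x) : ℝ≥0∞) ∂μ)

lemma coeFn_compQuasi (f : Ω →ₘ[μ] ℝ) :
    ∀ᵐ x ∂μ', f.compQuasiMeasurePreserving π hπ x = f (π x) :=
  f.coeFn_compQuasiMeasurePreserving hπ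

/-- Composition with a quasi measure preserving map that does not increase modulars. -/
noncomputable def compLM : OrliczSpace Φ μ →ₗ[ℝ] OrliczSpace Ψ μ' where
  toFun f := ⟨f.1.compQuasiMeasurePreserving π hπ, by
    change ∫⁻ x, (Ψ ‖f.1.compQuasiMeasurePreserving π hπ x‖₊ : ℝ≥0∞) ∂μ' < ∞
    refine lt_of_le_of_lt ?_ f.lintegral_lt_top
    refine le_trans (le_of_eq (lintegral_congr_ae ?_)) (h _ f.measurable.nnnorm)
    filter_upwards [coeFn_compQuasi π hπ f.1] with x hx
    rw [hx]⟩
  map_add' f g := by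
    refine Subtype.ext (AEEqFun.ext ?_)
    filter_upwards [coeFn_compQuasi π hπ (f + g).1, coeFn_compQuasi π hπ f.1,
      coeFn_compQuasi π hπ g.1, hπ.ae (coeFn_add f g), AEEqFun.coeFn_add
      (f.1.compQuasiMeasurePreserving π hπ) (g.1.compQuasiMeasurePreserving π hπ)]
      with x h1 h2 h3 h4 h5
    refine (h1.trans h4).trans ?_
    refine Eq.trans ?_ h5.symm
    rw [Pi.add_apply, h2, h3]
  map_smul' c f := by
    refine Subtype.ext (AEEqFun.ext ?_)
    filter_upwards [coeFn_compQuasi π hπ (c • f).1, coeFn_compQuasi π hπ f.1,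
      hπ.ae (coeFn_smul c f), AEEqFun.coeFn_smul c (f.1.compQuasiMeasurePreserving π hπ)]
      with x h1 h2 h3 h4
    refine (h1.trans h3).trans ?_
    refine Eq.trans ?_ h4.symm
    rw [Pi.smul_apply, h2, smul_eq_mul]

lemma coeFn_compLM (f : OrliczSpace Φ μ) : ∀ᵐ x ∂μ', compLM π hπ h f x = f (π x) :=
  coeFn_compQuasi π hπ f.1

lemma norm_compLM_le (f : OrliczSpace Φ μ) : ‖compLM π hπ h f‖ ≤ ‖f‖ := by
  refine norm_le_norm_of_lintegral_le fun r _ => ?_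
  refine le_trans (le_of_eq (lintegral_congr_ae ?_)) (h _ (f.measurable.nnnorm.div_const r))
  filter_upwards [coeFn_compLM π hπ h f] with x hx
  rw [hx]

end Comp

/-! ### Averaging over the fibres of a map to `ℕ`. -/

section Average

variable {ν : Measure ℕ} {π : Ω → ℕ} (hπ : MeasurePreserving π μ ν) (hν : ∀ k, ν {k} ≠ ∞)

include hπ in
lemma lintegral_eq_tsum_fiber (f : Ω → ℝ≥0∞) :
    ∫⁻ x, f x ∂μ = ∑' k, ∫⁻ x in π ⁻¹' {k}, f x ∂μ := by
  rw [← lintegral_iUnion (fun k => hπ.measurable (measurableSet_singleton k))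
    (fun i j hij => Disjoint.preimage _ (by simpa using hij)), ← Set.preimage_iUnion,
    Set.iUnion_of_singleton, Set.preimage_univ, Measure.restrict_univ]

include hπ in
lemma measure_fiber (k : ℕ) : μ (π ⁻¹' {k}) = ν {k} :=
  hπ.measure_preimage (measurableSet_singleton k).nullMeasurableSet

-- Jensen on each fibre, summed over the fibres; the fibre over `k` has measure `ν {k}`.
include hπ hν in
lemma lintegral_average_le (f : OrliczSpace Φ μ) (r : ℝ≥0) :
    ∫⁻ k, (Φ (‖⨍ x in π ⁻¹' {k}, f x ∂μ‖₊ / r) : ℝ≥0∞) ∂ν ≤ ∫⁻ x, (Φ (‖f x‖₊ / r) : ℝ≥0∞) ∂μ := by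
  rw [lintegral_countable', lintegral_eq_tsum_fiber hπ]
  refine ENNReal.tsum_le_tsum fun k => ?_
  rw [← measure_fiber hπ k]
  have hS : μ (π ⁻¹' {k}) ≠ ∞ := measure_fiber hπ k ▸ hν k
  have h := Φ.map_setAverage_mul_le hS ((f.integrableOn hS).div_const (r : ℝ))
  have e : ⨍ x in π ⁻¹' {k}, f x / r ∂μ = (⨍ x in π ⁻¹' {k}, f x ∂μ) / r := by
    rw [setAverage_eq, setAverage_eq, integral_div, smul_eq_mul, smul_eq_mul, mul_div_assoc]
  rw [e] at h
  simpa only [nnnorm_div, NNReal.nnnorm_eq] using h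

include hπ hν in
lemma average_add (f g : OrliczSpace Φ μ) (k : ℕ) : ⨍ x in π ⁻¹' {k}, (f + g) x ∂μ
    = ⨍ x in π ⁻¹' {k}, f x ∂μ + ⨍ x in π ⁻¹' {k}, g x ∂μ := by
  have hS : μ (π ⁻¹' {k}) ≠ ∞ := measure_fiber hπ k ▸ hν k
  rw [setAverage_eq, setAverage_eq, setAverage_eq, ← smul_add,
    ← integral_add (f.integrableOn hS) (g.integrableOn hS)]
  congr 1
  exact integral_congr_ae (ae_restrict_of_ae (coeFn_add f g))

lemma average_smul (c : ℝ) (f : OrliczSpace Φ μ) (S : Set Ω) :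
    ⨍ x in S, (c • f) x ∂μ = c * ⨍ x in S, f x ∂μ := by
  rw [setAverage_eq, setAverage_eq, ← smul_eq_mul c, smul_comm, smul_eq_mul c,
    ← integral_const_mul]
  congr 1
  exact integral_congr_ae (ae_restrict_of_ae (coeFn_smul c f))

/-- The averages over the fibres of a measurable map to `ℕ`. -/
noncomputable def averageLM : OrliczSpace Φ μ →ₗ[ℝ] OrliczSpace Φ ν where
  toFun f := ⟨natMk ν fun k => ⨍ x in π ⁻¹' {k}, f x ∂μ, by
    change ∫⁻ k, (Φ ‖natMk ν (fun k => ⨍ x in π ⁻¹' {k}, f x ∂μ) k‖₊ : ℝ≥0∞) ∂ν < ∞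
    refine lt_of_le_of_lt ?_ f.lintegral_lt_top
    have h := lintegral_average_le hπ hν f 1
    simp only [div_one] at h
    refine le_trans (le_of_eq (lintegral_congr_ae ?_)) h
    filter_upwards [coeFn_natMk ν fun k => ⨍ x in π ⁻¹' {k}, f x ∂μ] with k hk
    rw [hk]⟩
  map_add' f g := Subtype.ext <| by
    change natMk ν _ = natMk ν _ + natMk ν _
    rw [← natMk_add]
    exact congrArg (natMk ν) (funext (average_add hπ hν f g))
  map_smul' c f := Subtype.ext <| by
    change natMk ν _ = c • natMk ν _
    rw [← natMk_smul]
    exact congrArg (natMk ν) (funext fun k => average_smul c f _)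

lemma coeFn_averageLM (f : OrliczSpace Φ μ) :
    ∀ᵐ k ∂ν, averageLM hπ hν f k = ⨍ x in π ⁻¹' {k}, f x ∂μ :=
  coeFn_natMk ν _

lemma norm_averageLM_le (f : OrliczSpace Φ μ) : ‖averageLM hπ hν f‖ ≤ ‖f‖ := by
  refine norm_le_norm_of_lintegral_le fun r _ => ?_
  refine le_trans (le_of_eq (lintegral_congr_ae ?_)) (lintegral_average_le hπ hν f r)
  filter_upwards [coeFn_averageLM hπ hν f] with x hx
  rw [hx]

/-- Functions that are constant on the fibres of a measurable map to `ℕ`. -/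
noncomputable def fiberLM : OrliczSpace Φ ν →ₗ[ℝ] OrliczSpace Φ μ :=
  compLM π hπ.quasiMeasurePreserving fun f hf =>
    (hπ.lintegral_comp (f := fun k => (Φ (f k) : ℝ≥0∞))
      (Φ.measurable.comp hf).coe_nnreal_ennreal).le

lemma coeFn_fiberLM (f : OrliczSpace Φ ν) : ∀ᵐ x ∂μ, fiberLM hπ f x = f (π x) :=
  coeFn_compLM ..

lemma norm_fiberLM_le (f : OrliczSpace Φ ν) : ‖fiberLM hπ f‖ ≤ ‖f‖ := norm_compLM_le ..

/-- A constant is its own average over a fibre of positive finite measure, and null fibres are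
invisible to `ν`. -/
lemma averageLM_fiberLM (f : OrliczSpace Φ ν) : averageLM hπ hν (fiberLM hπ f) = f := by
  refine ext ?_
  filter_upwards [coeFn_averageLM hπ hν (fiberLM hπ f),
    ae_iff_of_countable.2 fun k hk => hk] with k hk hk0
  have hS : μ (π ⁻¹' {k}) ≠ ∞ := measure_fiber hπ k ▸ hν k
  have hS0 : μ (π ⁻¹' {k}) ≠ 0 := measure_fiber hπ k ▸ hk0
  rw [hk, ← setAverage_const hS0 hS (f k), setAverage_eq, setAverage_eq]
  congr 1
  refine setIntegral_congr_ae (hπ.measurable (measurableSet_singleton k)) ?_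
  filter_upwards [coeFn_fiberLM hπ f] with x hx hxk
  rw [hx, hxk]

lemma coeFn_fiberLM_averageLM (f : OrliczSpace Φ μ) :
    ∀ᵐ x ∂μ, fiberLM hπ (averageLM hπ hν f) x = ⨍ y in π ⁻¹' {π x}, f y ∂μ := by
  filter_upwards [coeFn_fiberLM hπ (averageLM hπ hν f),
    hπ.quasiMeasurePreserving.ae (coeFn_averageLM hπ hν f)] with x h1 h2
  rw [h1, h2]

lemma lintegral_fiberLM_averageLM_le (f : OrliczSpace Φ μ) :
    ∫⁻ x, (Φ ‖fiberLM hπ (averageLM hπ hν f) x‖₊ : ℝ≥0∞) ∂μ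
      ≤ ∫⁻ x, (Φ ‖f x‖₊ : ℝ≥0∞) ∂μ := by
  have h := lintegral_average_le hπ hν f 1
  simp only [div_one] at h
  rw [← hπ.lintegral_comp (f := fun k => (Φ ‖⨍ x in π ⁻¹' {k}, f x ∂μ‖₊ : ℝ≥0∞))
    (measurable_of_countable _)] at h
  refine le_trans (le_of_eq (lintegral_congr_ae ?_)) h
  filter_upwards [coeFn_fiberLM_averageLM hπ hν f] with x hx
  rw [hx]

end Average

/-! ### From almost everywhere to norm convergence. -/

section Convergence

open Filter Topology

/-- By `Δ₂`, dividing `g n` by `2⁻ᵐ` enlarges the modular by at most a constant `K` depending on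
`m`. Once `K` times the modular is at most 1, the norm is at most `2⁻ᵐ`. -/
lemma tendsto_zero_of_lintegral_tendsto {g : ℕ → OrliczSpace Φ μ}
    (h : Tendsto (fun n => ∫⁻ x, (Φ ‖g n x‖₊ : ℝ≥0∞) ∂μ) atTop (𝓝 0)) :
    Tendsto g atTop (𝓝 0) := by
  rw [tendsto_zero_iff_norm_tendsto_zero]
  refine squeeze_zero_norm' (a := fun n => ‖g n‖) (by simp) ?_
  refine tendsto_order.2 ⟨fun a ha => Eventually.of_forall fun n => ha.trans_le (norm_nonneg _),
    fun ε hε => ?_⟩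
  obtain ⟨m, hm⟩ := exists_pow_lt_of_lt_one hε (one_half_lt_one (α := ℝ))
  obtain ⟨K, hK⟩ := Φ.exists_delta2_pow m
  have hlim := ENNReal.Tendsto.const_mul h (Or.inr (ENNReal.coe_ne_top (r := K)))
  rw [mul_zero] at hlim
  filter_upwards [hlim.eventually_le_const one_pos] with n hn
  refine (norm_le_of_mem (r := (1 / 2) ^ m) ⟨by positivity, ?_⟩).trans_lt (by exact_mod_cast hm)
  refine le_trans ?_ hn
  rw [← lintegral_const_mul' _ _ ENNReal.coe_ne_top]
  refine lintegral_mono fun x => ?_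
  have e : ‖g n x‖₊ / (1 / 2) ^ m = 2 ^ m * ‖g n x‖₊ := by
    rw [one_div, inv_pow, div_inv_eq_mul, mul_comm]
  rw [e, ← ENNReal.coe_mul]
  exact ENNReal.coe_le_coe.2 (hK _)

/-- Convergence almost everywhere without increase of the modular implies norm convergence. -/
theorem tendsto_of_ae_tendsto {g : ℕ → OrliczSpace Φ μ} {f : OrliczSpace Φ μ}
    (hg : ∀ n, ∫⁻ x, (Φ ‖g n x‖₊ : ℝ≥0∞) ∂μ ≤ ∫⁻ x, (Φ ‖f x‖₊ : ℝ≥0∞) ∂μ)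
    (hae : ∀ᵐ x ∂μ, Tendsto (fun n => g n x) atTop (𝓝 (f x))) : Tendsto g atTop (𝓝 f) := by
  obtain ⟨K, hK⟩ := Φ.exists_delta2
  rw [← tendsto_sub_nhds_zero_iff]
  refine tendsto_zero_of_lintegral_tendsto ?_
  let F : Ω → ℝ≥0 := fun x => Φ ‖f x‖₊
  let G : ℕ → Ω → ℝ≥0 := fun n x => Φ ‖g n x‖₊
  let D : ℕ → Ω → ℝ≥0 := fun n x => Φ ‖g n x - f x‖₊
  have hFm : Measurable F := Φ.measurable.comp f.measurable.nnnorm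
  have hGm : ∀ n, Measurable (G n) := fun n => Φ.measurable.comp (g n).measurable.nnnorm
  have hDm : ∀ n, Measurable (D n) := fun n =>
    Φ.measurable.comp ((g n).measurable.sub f.measurable).nnnorm
  have hD : ∀ n x, D n x ≤ K * (G n x + F x) := fun n x => by
    have hle : ‖g n x - f x‖₊ ≤ ‖g n x‖₊ + ‖f x‖₊ := nnnorm_sub_le _ _
    rcases le_total ‖g n x‖₊ ‖f x‖₊ with h | h
    · refine (Φ.mono (hle.trans ?_)).trans ((hK ‖f x‖₊).trans
        (mul_le_mul_right le_add_self K))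
      rw [two_mul]
      gcongr
    · refine (Φ.mono (hle.trans ?_)).trans ((hK ‖g n x‖₊).trans
        (mul_le_mul_right le_self_add K))
      rw [two_mul]
      gcongr
  -- Fatou is applied to this function, nonnegative by `Δ₂`, which tends a.e. to `2KΦ(|f|)`. As `∫ H
  -- n + ∫ D n` is at most the integral of that limit, `∫ D n` must tend to 0.
  let H : ℕ → Ω → ℝ≥0 := fun n x => K * (G n x + F x) - D n x
  have hHm : ∀ n, Measurable (H n) := fun n => (((hGm n).add hFm).const_mul K).sub (hDm n)
  have hHD : ∀ n, ∫⁻ x, H n x ∂μ + ∫⁻ x, D n x ∂μ ≤ K * (2 * ∫⁻ x, F x ∂μ) := fun n => by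
    rw [← lintegral_add_left (hHm n).coe_nnreal_ennreal]
    calc ∫⁻ x, ((H n x : ℝ≥0∞) + D n x) ∂μ = ∫⁻ x, (K : ℝ≥0∞) * (G n x + F x) ∂μ := by
          refine lintegral_congr fun x => ?_
          exact_mod_cast tsub_add_cancel_of_le (hD n x)
      _ = K * (∫⁻ x, G n x ∂μ + ∫⁻ x, F x ∂μ) := by
          rw [lintegral_const_mul' _ _ ENNReal.coe_ne_top,
            lintegral_add_left (hGm n).coe_nnreal_ennreal]
      _ ≤ K * (2 * ∫⁻ x, F x ∂μ) := by
          rw [two_mul]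
          exact mul_le_mul' le_rfl (add_le_add (hg n) le_rfl)
  have hHlim : ∀ᵐ x ∂μ, Tendsto (fun n => (H n x : ℝ≥0∞)) atTop (𝓝 (K * (2 * F x) : ℝ≥0)) := by
    filter_upwards [hae] with x hx
    refine ENNReal.tendsto_coe.2 ?_
    have h1 : Tendsto (fun n => G n x) atTop (𝓝 (F x)) :=
      (Φ.continuous.tendsto _).comp ((_root_.continuous_nnnorm.tendsto _).comp hx)
    have h2 : Tendsto (fun n => D n x) atTop (𝓝 0) := by
      have h := (Φ.continuous.tendsto _).comp
        ((_root_.continuous_nnnorm.tendsto _).comp (hx.sub_const (f x)))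
      simp only [sub_self, nnnorm_zero, Φ.map_zero] at h
      exact h
    have h := ((h1.add_const (F x)).const_mul K).sub h2
    rwa [tsub_zero, ← two_mul] at h
  have hA : (K * (2 * ∫⁻ x, F x ∂μ) : ℝ≥0∞) ≤ liminf (fun n => ∫⁻ x, H n x ∂μ) atTop := by
    refine le_trans (le_of_eq ?_) (lintegral_liminf_le fun n => (hHm n).coe_nnreal_ennreal)
    rw [← lintegral_const_mul' _ _ ENNReal.ofNat_ne_top,
      ← lintegral_const_mul' _ _ ENNReal.coe_ne_top]
    refine lintegral_congr_ae ?_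
    filter_upwards [hHlim] with x hx
    rw [hx.liminf_eq]
    push_cast
    rfl
  have hAfin : (K * (2 * ∫⁻ x, F x ∂μ) : ℝ≥0∞) ≠ ∞ :=
    ENNReal.mul_ne_top ENNReal.coe_ne_top (ENNReal.mul_ne_top ENNReal.ofNat_ne_top f.2.ne)
  generalize (K * (2 * ∫⁻ x, F x ∂μ) : ℝ≥0∞) = A at hHD hA hAfin
  have hlim : Tendsto (fun n => ∫⁻ x, D n x ∂μ) atTop (𝓝 0) := by
    refine ENNReal.tendsto_nhds_zero.2 fun ε hε => ?_
    have hev : ∀ᶠ n in atTop, A ≤ ∫⁻ x, H n x ∂μ + ε := by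
      -- For `A = 0` the strict inequality `A - ε < A` used below fails.
      rcases eq_or_ne A 0 with rfl | hA0
      · exact Eventually.of_forall fun n => zero_le
      · filter_upwards [eventually_lt_of_lt_liminf ((ENNReal.sub_lt_self hAfin hA0 hε.ne').trans_le
          hA)] with n hn
        exact tsub_le_iff_right.1 hn.le
    filter_upwards [hev] with n hn
    have hfin : ∫⁻ x, H n x ∂μ ≠ ∞ := (le_self_add.trans (hHD n)).trans_lt hAfin.lt_top |>.ne
    exact (ENNReal.add_le_add_iff_left hfin).1 ((hHD n).trans hn)
  refine hlim.congr fun n => lintegral_congr_ae ?_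
  filter_upwards [coeFn_sub (g n) f] with x hx
  rw [hx]

end Convergence

end OrliczSpace

/-! ### Averages over short intervals -/

section Intervals

open Filter Topology

/-- The index of the interval `[kα, (k+1)α)` that contains `x`. -/
noncomputable def cell (α : ℝ) (x : ℝ) : ℕ := ⌊x / α⌋₊

lemma measurable_cell (α : ℝ) : Measurable (cell α) :=
  Nat.measurable_floor.comp (measurable_id.div_const α)

lemma cell_eq_iff {α x : ℝ} (hα : 0 < α) (hx : 0 ≤ x) (k : ℕ) :
    cell α x = k ↔ x ∈ Set.Ico (k * α) ((k + 1) * α) := by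
  rw [cell, Nat.floor_eq_iff (div_nonneg hx hα.le), le_div_iff₀ hα, div_lt_iff₀ hα, Set.mem_Ico]

variable {s : Set ℝ}

/-- `⌊·⌋₊` sends negative reals to 0, so the fibres are intervals only inside `[0, ∞)`. -/
lemma cell_preimage_inter {α : ℝ} (hα : 0 < α) (hs : s ⊆ Set.Ici 0) (k : ℕ) :
    cell α ⁻¹' {k} ∩ s = Set.Ico (k * α) ((k + 1) * α) ∩ s := by
  ext x
  exact and_congr_left fun hx => cell_eq_iff hα (hs hx) k

lemma map_cell_singleton {α : ℝ} (hα : 0 < α) (hs : s ⊆ Set.Ici 0) (k : ℕ) :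
    (volume.restrict s).map (cell α) {k} = volume (Set.Ico (k * α) ((k + 1) * α) ∩ s) := by
  have hk := measurable_cell α (measurableSet_singleton k)
  rw [Measure.map_apply (measurable_cell α) (measurableSet_singleton k), Measure.restrict_apply hk,
    cell_preimage_inter hα hs]

lemma map_cell_singleton_ne_top {α : ℝ} (hα : 0 < α) (hs : s ⊆ Set.Ici 0) (k : ℕ) :
    (volume.restrict s).map (cell α) {k} ≠ ∞ := by
  rw [map_cell_singleton hα hs]
  exact ((measure_mono Set.inter_subset_left).trans_lt measure_Ico_lt_top).ne

lemma map_cell_Ici_singleton {α : ℝ} (hα : 0 < α) (k : ℕ) :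
    (volume.restrict (Set.Ici (0 : ℝ))).map (cell α) {k} = ENNReal.ofReal α := by
  have h : Set.Ico ((k : ℝ) * α) ((k + 1) * α) ⊆ Set.Ici 0 := fun x hx =>
    Set.mem_Ici.2 ((mul_nonneg k.cast_nonneg hα.le).trans hx.1)
  rw [map_cell_singleton hα subset_rfl, Set.inter_eq_left.2 h, Real.volume_Ico]
  ring_nf

lemma measurePreserving_cell (α : ℝ) :
    MeasurePreserving (cell α) (volume.restrict s) ((volume.restrict s).map (cell α)) :=
  (measurable_cell α).measurePreserving _

/-- Up to an endpoint a cell is a closed ball around its midpoint, the form needed for Lebesgue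
differentiation on a doubling space. -/
lemma restrict_cell_preimage {α : ℝ} (hα : 0 < α) (hs : s ⊆ Set.Ici 0) {k : ℕ}
    (h : Set.Ico (k * α) ((k + 1) * α) ⊆ s) :
    (volume.restrict s).restrict (cell α ⁻¹' {k})
      = volume.restrict (Metric.closedBall ((k + 1 / 2) * α) (α / 2)) := by
  rw [Measure.restrict_restrict (measurable_cell α (measurableSet_singleton k)),
    cell_preimage_inter hα hs, Set.inter_eq_left.2 h, Real.closedBall_eq_Icc]
  have e1 : ((k : ℝ) + 1 / 2) * α - α / 2 = k * α := by ring
  have e2 : ((k : ℝ) + 1 / 2) * α + α / 2 = (k + 1) * α := by ring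
  rw [e1, e2]
  exact Measure.restrict_congr_set Ico_ae_eq_Icc

namespace OrliczSpace

variable {Φ : YoungFunctionDelta2}

lemma locallyIntegrable_indicator (hsm : MeasurableSet s)
    (f : OrliczSpace Φ (volume.restrict s)) : LocallyIntegrable (s.indicator f) volume := by
  rw [locallyIntegrable_iff]
  intro K hK
  rw [IntegrableOn, integrable_indicator_iff hsm, IntegrableOn, Measure.restrict_comm hsm]
  exact f.integrableOn ((Measure.restrict_apply_le _ _).trans_lt hK.measure_lt_top).ne

/-- Lebesgue's differentiation theorem for averages over cells. -/
lemma ae_tendsto_average_cell (hsm : MeasurableSet s) (hs : s ⊆ Set.Ici 0)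
    (hint : ∀ᵐ x ∂volume.restrict s, s ∈ 𝓝 x) {α : ℕ → ℝ} (hα : ∀ n, 0 < α n)
    (hlim : Tendsto α atTop (𝓝 0)) (f : OrliczSpace Φ (volume.restrict s)) :
    ∀ᵐ x ∂volume.restrict s, Tendsto
      (fun n => ⨍ y in cell (α n) ⁻¹' {cell (α n) x}, f y ∂volume.restrict s) atTop
      (𝓝 (f x)) := by
  filter_upwards [hint, ae_restrict_mem hsm, ae_restrict_of_ae
    (IsUnifLocDoublingMeasure.ae_tendsto_average volume (f.locallyIntegrable_indicator hsm) 1)]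
    with x hx hxs hav
  have hmem : ∀ n, x ∈ Set.Ico ((cell (α n) x : ℝ) * α n) ((cell (α n) x + 1) * α n) := fun n =>
    (cell_eq_iff (hα n) (hs hxs) _).1 rfl
  -- The balls are not centred at `x`, but `x` lies in each of them, as differentiation with
  -- parameter 1 requires.
  have h := hav (l := atTop) (fun n => ((cell (α n) x : ℝ) + 1 / 2) * α n) (fun n => α n / 2)
    (tendsto_nhdsWithin_iff.2 ⟨by simpa using hlim.div_const 2,
      Eventually.of_forall fun n => half_pos (hα n)⟩)
    (Eventually.of_forall fun n => by
      have h1 := hmem n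
      rw [one_mul, Real.closedBall_eq_Icc]
      constructor
      · linarith [h1.1]
      · linarith [h1.2])
  rw [Set.indicator_of_mem hxs] at h
  refine h.congr' ?_
  -- Near `x` the cells eventually lie inside `s`, so averaging over the fibre agrees with averaging
  -- the zero extension over the ball.
  obtain ⟨ε, hε, hball⟩ := Metric.mem_nhds_iff.1 hx
  filter_upwards [hlim.eventually_lt_const hε] with n hn
  have hsub : Set.Ico ((cell (α n) x : ℝ) * α n) ((cell (α n) x + 1) * α n) ⊆ s := fun y hy =>
    hball (by
      have h1 := hmem n
      rw [Metric.mem_ball, Real.dist_eq, abs_lt]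
      constructor
      · linarith [h1.2, hy.1]
      · linarith [h1.1, hy.2])
  rw [← restrict_cell_preimage (hα n) hs hsub]
  refine average_congr (ae_restrict_of_ae ?_)
  filter_upwards [ae_restrict_mem hsm] with y hy
  exact Set.indicator_of_mem hy _

/-- The averaging projections over cells converge to the identity. -/
theorem tendsto_fiberLM_averageLM_cell (hsm : MeasurableSet s) (hs : s ⊆ Set.Ici 0)
    (hint : ∀ᵐ x ∂volume.restrict s, s ∈ 𝓝 x) {α : ℕ → ℝ} (hα : ∀ n, 0 < α n)
    (hlim : Tendsto α atTop (𝓝 0)) (f : OrliczSpace Φ (volume.restrict s)) :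
    Tendsto (fun n => fiberLM (measurePreserving_cell (α n)) (averageLM
      (measurePreserving_cell (α n)) (map_cell_singleton_ne_top (hα n) hs) f)) atTop (𝓝 f) := by
  refine tendsto_of_ae_tendsto (fun n => lintegral_fiberLM_averageLM_le _ _ f) ?_
  filter_upwards [ae_tendsto_average_cell hsm hs hint hα hlim f, ae_all_iff.2 fun n =>
    coeFn_fiberLM_averageLM (measurePreserving_cell (α n))
      (map_cell_singleton_ne_top (hα n) hs) f] with x hx h
  exact hx.congr fun n => (h n).symm

/-! ### Measures on `ℕ` with equal atoms and the sequence space `ℓ_{αΦ}`. -/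

section Scale

variable {ν : Measure ℕ} {α : ℝ≥0} (hα : 0 < α) (hν : ∀ k, ν {k} = α)

include hν in
lemma lintegral_eq_of_singleton (f : ℕ → ℝ≥0) :
    ∫⁻ k, (Φ (f k) : ℝ≥0∞) ∂ν = ∫⁻ k, (Φ.scale α hα (f k) : ℝ≥0∞) ∂Measure.count := by
  rw [lintegral_countable', lintegral_countable']
  refine tsum_congr fun k => ?_
  rw [hν, Measure.count_singleton, mul_one, mul_comm, ← ENNReal.coe_mul]
  rfl

-- Atoms of positive mass leave only the empty null set, so `ν` and the counting measure have the
-- same classes of functions.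
include hα hν in
lemma ae_iff_forall_of_singleton {p : ℕ → Prop} : (∀ᵐ k ∂ν, p k) ↔ ∀ k, p k := by
  rw [ae_iff_of_countable]
  refine forall_congr' fun k => ⟨fun h => h ?_, fun h _ => h⟩
  rw [hν]
  exact ENNReal.coe_ne_zero.2 hα.ne'

include hα hν in
lemma quasiMeasurePreserving_count :
    Measure.QuasiMeasurePreserving id (Measure.count : Measure ℕ) ν :=
  ⟨measurable_id, by
    rw [Measure.map_id]
    refine Measure.ae_le_iff_absolutelyContinuous.1 fun t ht => ?_
    have h := (ae_iff_forall_of_singleton hα hν (p := fun k => k ∈ t)).1 ht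
    exact Eventually.of_forall h⟩

include hα hν in
lemma quasiMeasurePreserving_of_singleton :
    Measure.QuasiMeasurePreserving id ν (Measure.count : Measure ℕ) :=
  ⟨measurable_id, by
    rw [Measure.map_id]
    refine Measure.ae_le_iff_absolutelyContinuous.1 fun t ht => ?_
    refine (ae_iff_forall_of_singleton hα hν (p := fun k => k ∈ t)).2 fun k => ?_
    exact (ae_iff_of_countable.1 (show ∀ᵐ k ∂Measure.count, k ∈ t from ht)) k (by simp)⟩

/-- If all atoms of `ν` have mass `α`, then `L_Φ(ν)` maps onto `ℓ_{αΦ}`. -/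
noncomputable def toSeqLM : OrliczSpace Φ ν →ₗ[ℝ] OrliczSeq (Φ.scale α hα) :=
  compLM id (quasiMeasurePreserving_count hα hν) fun f _ =>
    (lintegral_eq_of_singleton hα hν f).ge

/-- If all atoms of `ν` have mass `α`, then `ℓ_{αΦ}` maps onto `L_Φ(ν)`. -/
noncomputable def ofSeqLM : OrliczSeq (Φ.scale α hα) →ₗ[ℝ] OrliczSpace Φ ν :=
  compLM id (quasiMeasurePreserving_of_singleton hα hν) fun f _ =>
    (lintegral_eq_of_singleton hα hν f).le

lemma norm_toSeqLM_le (f : OrliczSpace Φ ν) : ‖toSeqLM hα hν f‖ ≤ ‖f‖ := norm_compLM_le ..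

lemma norm_ofSeqLM_le (f : OrliczSeq (Φ.scale α hα)) : ‖ofSeqLM hα hν f‖ ≤ ‖f‖ :=
  norm_compLM_le ..

lemma ofSeqLM_toSeqLM (f : OrliczSpace Φ ν) : ofSeqLM hα hν (toSeqLM hα hν f) = f := by
  refine ext ?_
  filter_upwards [coeFn_compLM id (quasiMeasurePreserving_of_singleton hα hν)
    (fun f _ => (lintegral_eq_of_singleton hα hν f).le) (toSeqLM hα hν f),
    (quasiMeasurePreserving_of_singleton hα hν).ae (coeFn_compLM id
      (quasiMeasurePreserving_count hα hν)
      (fun f _ => (lintegral_eq_of_singleton hα hν f).ge) f)] with k h1 h2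
  exact h1.trans h2

lemma toSeqLM_ofSeqLM (f : OrliczSeq (Φ.scale α hα)) : toSeqLM hα hν (ofSeqLM hα hν f) = f := by
  refine ext ?_
  filter_upwards [coeFn_compLM id (quasiMeasurePreserving_count hα hν)
    (fun f _ => (lintegral_eq_of_singleton hα hν f).ge) (ofSeqLM hα hν f),
    (quasiMeasurePreserving_count hα hν).ae (coeFn_compLM id
      (quasiMeasurePreserving_of_singleton hα hν)
      (fun f _ => (lintegral_eq_of_singleton hα hν f).le) f)] with k h1 h2
  exact h1.trans h2

end Scale

lemma ae_Ici_mem_nhds : ∀ᵐ x ∂volume.restrict (Set.Ici (0 : ℝ)), Set.Ici (0 : ℝ) ∈ 𝓝 x := by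
  rw [Measure.restrict_congr_set (Ioi_ae_eq_Ici (a := (0 : ℝ))).symm]
  filter_upwards [ae_restrict_mem measurableSet_Ioi] with x hx
  exact Ici_mem_nhds hx

lemma ae_Icc_mem_nhds {a b : ℝ} : ∀ᵐ x ∂volume.restrict (Set.Icc a b), Set.Icc a b ∈ 𝓝 x := by
  rw [Measure.restrict_congr_set (Ioo_ae_eq_Icc (a := a) (b := b)).symm]
  filter_upwards [ae_restrict_mem measurableSet_Ioo] with x hx
  exact Icc_mem_nhds hx.1 hx.2

/-- `Lip₀(L_Φ[0, ∞)) ≃ ⨁ Lip₀(ℓ_{α_n Φ})` whenever `α_n → 0`. -/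
theorem nonempty_lipZero_halfLine_equiv (Φ : YoungFunctionDelta2) (α : ℕ → ℝ≥0)
    (hα : ∀ n, 0 < α n) (hlim : Tendsto α atTop (𝓝 0)) :
    Nonempty (LipZero (OrliczHalfLine Φ) 0 ≃L[ℝ]
      lp (fun n : ℕ => LipZero (OrliczSeq (Φ.scale (α n) (hα n))) 0) ∞) := by
  have hα' : ∀ n, (0 : ℝ) < α n := fun n => hα n
  have hlim' : Tendsto (fun n => (α n : ℝ)) atTop (𝓝 0) := NNReal.tendsto_coe.2 hlim
  have hν : ∀ n k, (volume.restrict (Set.Ici (0 : ℝ))).map (cell (α n)) {k} = α n := fun n k => by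
    rw [map_cell_Ici_singleton (hα' n), ENNReal.ofReal_coe_nnreal]
  have hfin : ∀ n k, (volume.restrict (Set.Ici (0 : ℝ))).map (cell (α n)) {k} ≠ ∞ := fun n =>
    map_cell_singleton_ne_top (hα' n) subset_rfl
  refine LipZero.nonempty_equiv_sum
    (fun n => (toSeqLM (hα n) (hν n)).comp
      (averageLM (measurePreserving_cell (α n : ℝ)) (hfin n)))
    (fun n => (fiberLM (measurePreserving_cell (α n : ℝ))).comp (ofSeqLM (hα n) (hν n)))
    1 zero_le_one (fun n f => ?_) (fun n f => ?_) (fun f => ?_) (fun n f => ?_)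
  · rw [one_mul]
    exact (norm_toSeqLM_le (hα n) (hν n) _).trans (norm_averageLM_le _ (hfin n) _)
  · rw [one_mul]
    exact (norm_fiberLM_le (measurePreserving_cell _) _).trans (norm_ofSeqLM_le (hα n) (hν n) _)
  · refine (tendsto_fiberLM_averageLM_cell measurableSet_Ici subset_rfl ae_Ici_mem_nhds hα' hlim'
      f).congr fun n => ?_
    simp only [LinearMap.comp_apply, ofSeqLM_toSeqLM]
  · simp only [LinearMap.comp_apply, averageLM_fiberLM, toSeqLM_ofSeqLM]

end OrliczSpace

end Intervals

/-! ### Lebesgue spaces as Orlicz spaces -/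

section Lebesgue

open Filter Topology

/-- The Young function `x ↦ x ^ q`, for `1 ≤ q < ∞`. -/
noncomputable def powYoung (q : ℝ) (hq : 1 ≤ q) : YoungFunctionDelta2 where
  toFun x := x ^ q
  map_zero' := NNReal.zero_rpow (by linarith)
  convex' := ⟨convex_univ, fun x _ y _ a b _ _ hab => by
    have h := (convexOn_rpow hq).2 (x := (x : ℝ)) x.coe_nonneg (y := (y : ℝ)) y.coe_nonneg
      a.coe_nonneg b.coe_nonneg (by exact_mod_cast hab)
    simp only [smul_eq_mul] at h ⊢
    exact_mod_cast h⟩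
  strictMono' := NNReal.strictMono_rpow_of_pos (by linarith)
  delta2' := ⟨2 ^ q, NNReal.rpow_pos two_pos, fun x _ => (NNReal.mul_rpow).le⟩

lemma powYoung_apply (q : ℝ) (hq : 1 ≤ q) (x : ℝ≥0) : powYoung q hq x = x ^ q := rfl

variable {p : ℝ≥0∞} [hp1 : Fact (1 ≤ p)]

include hp1 in
lemma toReal_exponent_ge_one (hp : p ≠ ∞) : 1 ≤ p.toReal := by
  simpa using ENNReal.toReal_mono hp hp1.out

/-- The Young function of the Lebesgue space `L_p`. -/
noncomputable abbrev lebesgueYoung (hp : p ≠ ∞) : YoungFunctionDelta2 :=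
  powYoung p.toReal (toReal_exponent_ge_one hp)

variable {Ω : Type*} [MeasurableSpace Ω] {μ : Measure Ω} (hp : p ≠ ∞)

lemma coe_lebesgueYoung (x : ℝ≥0) : (lebesgueYoung hp x : ℝ≥0∞) = (x : ℝ≥0∞) ^ p.toReal :=
  ENNReal.coe_rpow_of_nonneg _ (zero_le_one.trans (toReal_exponent_ge_one hp))

omit hp1 in
lemma Lp.lintegral_enorm_rpow [Fact (1 ≤ p)] (hp : p ≠ ∞) (f : Lp ℝ p μ) :
    ∫⁻ x, ‖f x‖ₑ ^ p.toReal ∂μ = ‖f‖ₑ ^ p.toReal := by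
  have hq : 0 < p.toReal := one_pos.trans_le (toReal_exponent_ge_one hp)
  rw [Lp.enorm_def,
    eLpNorm_eq_lintegral_rpow_enorm_toReal (ne_of_gt (one_pos.trans_le Fact.out)) hp, ← ENNReal.rpow_mul, one_div, inv_mul_cancel₀ hq.ne', ENNReal.rpow_one]

lemma mem_orlicz_iff_mem_Lp (f : Ω →ₘ[μ] ℝ) :
    f ∈ orliczSubmodule (lebesgueYoung hp) μ ↔ f ∈ Lp ℝ p μ := by
  have hq : 0 < p.toReal := one_pos.trans_le (toReal_exponent_ge_one hp)
  rw [Lp.mem_Lp_iff_eLpNorm_lt_top, eLpNorm_eq_lintegral_rpow_enorm_toReal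
    (ne_of_gt (one_pos.trans_le Fact.out)) hp, ENNReal.rpow_lt_top_iff_of_pos (by positivity)]
  change ∫⁻ x, (lebesgueYoung hp ‖f x‖₊ : ℝ≥0∞) ∂μ < ∞ ↔ _
  simp only [coe_lebesgueYoung, enorm_eq_nnnorm]

/-- `L_p` as an Orlicz space. -/
noncomputable def lpToOrlicz : Lp ℝ p μ →ₗ[ℝ] OrliczSpace (lebesgueYoung hp) μ where
  toFun f := ⟨f.1, (mem_orlicz_iff_mem_Lp hp _).2 f.2⟩
  map_add' _ _ := rfl
  map_smul' _ _ := rfl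

/-- The Orlicz space of the function `x ^ p` as `L_p`. -/
noncomputable def orliczToLp : OrliczSpace (lebesgueYoung hp) μ →ₗ[ℝ] Lp ℝ p μ where
  toFun f := ⟨f.1, (mem_orlicz_iff_mem_Lp hp _).1 f.2⟩
  map_add' _ _ := rfl
  map_smul' _ _ := rfl

@[simp]
lemma orliczToLp_lpToOrlicz (f : Lp ℝ p μ) : orliczToLp hp (lpToOrlicz hp f) = f := rfl

@[simp]
lemma lpToOrlicz_orliczToLp (f : OrliczSpace (lebesgueYoung hp) μ) :
    lpToOrlicz hp (orliczToLp hp f) = f := rfl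

/-- By homogeneity the modular of `f / r` is `(‖f‖ / r) ^ p`, so the Luxemburg norm is the `L_p`
norm. -/
lemma mem_gaugeSet_lpToOrlicz_iff (f : Lp ℝ p μ) {r : ℝ≥0} (hr : 0 < r) :
    r ∈ OrliczSpace.gaugeSet (lpToOrlicz hp f) ↔ ‖f‖₊ ≤ r := by
  have hq : 0 < p.toReal := one_pos.trans_le (toReal_exponent_ge_one hp)
  have e : ∫⁻ x, (lebesgueYoung hp (‖lpToOrlicz hp f x‖₊ / r) : ℝ≥0∞) ∂μ
      = ((‖f‖₊ / r : ℝ≥0) : ℝ≥0∞) ^ p.toReal := by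
    have h : ∀ x : ℝ≥0, (lebesgueYoung hp (x / r) : ℝ≥0∞)
        = ((r⁻¹ ^ p.toReal : ℝ≥0) : ℝ≥0∞) * (x : ℝ≥0∞) ^ p.toReal := fun x => by
      rw [powYoung_apply, div_eq_inv_mul, NNReal.mul_rpow, ENNReal.coe_mul,
        ENNReal.coe_rpow_of_nonneg x hq.le]
    simp only [h]
    rw [lintegral_const_mul' _ _ ENNReal.coe_ne_top]
    rw [show ∫⁻ x, (‖lpToOrlicz hp f x‖₊ : ℝ≥0∞) ^ p.toReal ∂μ = ‖f‖ₑ ^ p.toReal from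
      Lp.lintegral_enorm_rpow hp f, enorm_eq_nnnorm, ENNReal.coe_rpow_of_nonneg _ hq.le,
      ← ENNReal.mul_rpow_of_nonneg _ _ hq.le, ← ENNReal.coe_mul, div_eq_inv_mul]
  have h1 : (‖f‖₊ / r) ^ p.toReal ≤ 1 ↔ ‖f‖₊ / r ≤ 1 := by
    simpa using NNReal.rpow_le_rpow_iff (x := ‖f‖₊ / r) (y := 1) hq
  change 0 < r ∧ _ ↔ _
  rw [and_iff_right hr, e, ← ENNReal.coe_rpow_of_nonneg _ hq.le, ENNReal.coe_le_one_iff,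
    h1, div_le_one hr]

lemma norm_lpToOrlicz (f : Lp ℝ p μ) : ‖lpToOrlicz hp f‖ = ‖f‖ := by
  rw [OrliczSpace.norm_def, ← coe_nnnorm, NNReal.coe_inj]
  refine le_antisymm (le_of_forall_pos_le_add fun ε hε => csInf_le (OrderBot.bddBelow _) ?_)
    (le_csInf (OrliczSpace.gaugeSet_nonempty _) fun r hr =>
      (mem_gaugeSet_lpToOrlicz_iff hp f hr.1).1 hr)
  -- The `ε` is needed because `‖f‖` itself may be 0, while the gauge set contains only positive
  -- numbers.
  exact (mem_gaugeSet_lpToOrlicz_iff hp f (add_pos_of_nonneg_of_pos zero_le hε)).2 le_self_add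

lemma norm_orliczToLp (f : OrliczSpace (lebesgueYoung hp) μ) : ‖orliczToLp hp f‖ = ‖f‖ := by
  rw [← norm_lpToOrlicz hp, lpToOrlicz_orliczToLp]

end Lebesgue

/-! ### `L_p` of an atomic measure and `ℓ_p` -/

section Atomic

open Filter Topology

variable {p : ℝ≥0∞} [hp1 : Fact (1 ≤ p)] (hp : p ≠ ∞) {ν : Measure ℕ} (hν : ∀ k, ν {k} ≠ ∞)

variable (p ν) in
/-- The norm in `L_p(ν)` of the indicator of the atom `k`. -/
noncomputable def atomWeight (k : ℕ) : ℝ := (ν {k}).toReal ^ (p.toReal)⁻¹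

include hp1 hp in
lemma toReal_exponent_pos : 0 < p.toReal := one_pos.trans_le (toReal_exponent_ge_one hp)

omit hp1 in
lemma atomWeight_nonneg (k : ℕ) : 0 ≤ atomWeight p ν k := Real.rpow_nonneg ENNReal.toReal_nonneg _

include hp1 hp in
lemma atomWeight_eq_zero {k : ℕ} (hk : ν {k} = 0) : atomWeight p ν k = 0 := by
  rw [atomWeight, hk, ENNReal.toReal_zero,
    Real.zero_rpow (inv_ne_zero (toReal_exponent_pos hp).ne')]

include hν in
omit hp1 in
lemma atomWeight_pos {k : ℕ} (hk : ν {k} ≠ 0) : 0 < atomWeight p ν k :=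
  Real.rpow_pos_of_pos (ENNReal.toReal_pos hk (hν k)) _

-- The weight `ν {k} ^ (1/p)` turns the weighted `p`-sum over the atoms into the plain one.
include hp1 hp hν in
lemma enorm_atomWeight_mul (k : ℕ) (t : ℝ) :
    ‖atomWeight p ν k * t‖ₑ ^ p.toReal = ‖t‖ₑ ^ p.toReal * ν {k} := by
  have hq := toReal_exponent_pos hp
  rw [enorm_mul, ENNReal.mul_rpow_of_nonneg _ _ hq.le, mul_comm]
  congr 1
  rw [Real.enorm_of_nonneg (atomWeight_nonneg k), atomWeight,
    ← ENNReal.ofReal_rpow_of_nonneg ENNReal.toReal_nonneg (inv_nonneg.2 hq.le),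
    ← ENNReal.rpow_mul, inv_mul_cancel₀ hq.ne', ENNReal.rpow_one, ENNReal.ofReal_toReal (hν k)]

include hp hν in
lemma sum_norm_atomWeight_mul_le (f : Lp ℝ p ν) (s : Finset ℕ) :
    ∑ k ∈ s, ‖atomWeight p ν k * f k‖ ^ p.toReal ≤ ‖f‖ ^ p.toReal := by
  have hq := toReal_exponent_pos hp
  rw [← ENNReal.ofReal_le_ofReal_iff (by positivity), ENNReal.ofReal_sum_of_nonneg
    (fun k _ => by positivity)]
  simp only [← ENNReal.ofReal_rpow_of_nonneg (norm_nonneg _) hq.le, ofReal_norm,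
    enorm_atomWeight_mul hp hν]
  rw [← Lp.lintegral_enorm_rpow hp f, lintegral_countable']
  exact ENNReal.sum_le_tsum s

/-- The map `L_p(ν) → ℓ_p`, for an atomic measure `ν`. -/
noncomputable def atomicToSeq : Lp ℝ p ν →ₗ[ℝ] lp (fun _ : ℕ => ℝ) p where
  toFun f := ⟨fun k => atomWeight p ν k * f k, memℓp_gen' (sum_norm_atomWeight_mul_le hp hν f)⟩
  map_add' f g := by
    ext k
    change atomWeight p ν k * (f + g) k = atomWeight p ν k * f k + atomWeight p ν k * g k
    rcases eq_or_ne (ν {k}) 0 with hk | hk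
    · simp [atomWeight_eq_zero hp hk]
    · rw [ae_iff_of_countable.1 (Lp.coeFn_add f g) k hk, Pi.add_apply, mul_add]
  map_smul' c f := by
    ext k
    change atomWeight p ν k * (c • f) k = c * (atomWeight p ν k * f k)
    rcases eq_or_ne (ν {k}) 0 with hk | hk
    · simp [atomWeight_eq_zero hp hk]
    · rw [ae_iff_of_countable.1 (Lp.coeFn_smul c f) k hk, Pi.smul_apply, smul_eq_mul,
        mul_left_comm]

lemma atomicToSeq_apply (f : Lp ℝ p ν) (k : ℕ) :
    atomicToSeq hp hν f k = atomWeight p ν k * f k := rfl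

lemma norm_atomicToSeq_le (f : Lp ℝ p ν) : ‖atomicToSeq hp hν f‖ ≤ ‖f‖ :=
  lp.norm_le_of_forall_sum_le (toReal_exponent_pos hp) (norm_nonneg f)
    (sum_norm_atomWeight_mul_le hp hν f)

-- Only an inequality: at a null atom the weight and its inverse are both 0, and that coordinate of
-- `x` is lost.
include hp hν in
lemma lintegral_seqToAtomic_le (x : lp (fun _ : ℕ => ℝ) p) :
    ∫⁻ k, ‖natMk ν (fun k => (atomWeight p ν k)⁻¹ * x k) k‖ₑ ^ p.toReal ∂ν
      ≤ ‖x‖ₑ ^ p.toReal := by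
  have hq := toReal_exponent_pos hp
  have e : ∫⁻ k, ‖natMk ν (fun k => (atomWeight p ν k)⁻¹ * x k) k‖ₑ ^ p.toReal ∂ν
      = ∫⁻ k, ‖(atomWeight p ν k)⁻¹ * x k‖ₑ ^ p.toReal ∂ν := by
    refine lintegral_congr_ae ?_
    filter_upwards [coeFn_natMk ν fun k => (atomWeight p ν k)⁻¹ * x k] with k hk
    rw [hk]
  have hx : ‖x‖ₑ ^ p.toReal = ∑' k, ‖x k‖ₑ ^ p.toReal := by
    have h := lp.hasSum_norm hq x
    rw [← ofReal_norm, ENNReal.ofReal_rpow_of_nonneg (norm_nonneg _) hq.le, ← h.tsum_eq,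
      ENNReal.ofReal_tsum_of_nonneg (fun k => by positivity) h.summable]
    simp only [← ENNReal.ofReal_rpow_of_nonneg (norm_nonneg _) hq.le, ofReal_norm]
  rw [e, hx, lintegral_countable']
  refine ENNReal.tsum_le_tsum fun k => ?_
  rw [← enorm_atomWeight_mul hp hν]
  rcases eq_or_ne (ν {k}) 0 with hk | hk
  · simp [atomWeight_eq_zero hp hk, hq]
  · rw [mul_inv_cancel_left₀ (atomWeight_pos hν hk).ne']

include hp hν in
lemma eLpNorm_seqToAtomic_le (x : lp (fun _ : ℕ => ℝ) p) :
    eLpNorm (natMk ν fun k => (atomWeight p ν k)⁻¹ * x k) p ν ≤ ‖x‖ₑ := by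
  have hq := toReal_exponent_pos hp
  rw [eLpNorm_eq_lintegral_rpow_enorm_toReal (ne_of_gt (one_pos.trans_le Fact.out)) hp, one_div,
    ENNReal.rpow_inv_le_iff hq]
  exact lintegral_seqToAtomic_le hp hν x

/-- The map `ℓ_p → L_p(ν)`, for an atomic measure `ν`. -/
noncomputable def seqToAtomic : lp (fun _ : ℕ => ℝ) p →ₗ[ℝ] Lp ℝ p ν where
  toFun x := ⟨natMk ν fun k => (atomWeight p ν k)⁻¹ * x k, Lp.mem_Lp_iff_eLpNorm_lt_top.2
    ((eLpNorm_seqToAtomic_le hp hν x).trans_lt enorm_lt_top)⟩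
  map_add' x y := Subtype.ext <| by
    change natMk ν _ = natMk ν _ + natMk ν _
    rw [← natMk_add]
    exact congrArg (natMk ν) (funext fun k => mul_add _ _ _)
  map_smul' c x := Subtype.ext <| by
    change natMk ν _ = c • natMk ν _
    rw [← natMk_smul]
    exact congrArg (natMk ν) (funext fun k => mul_left_comm _ _ _)

lemma coeFn_seqToAtomic (x : lp (fun _ : ℕ => ℝ) p) :
    ∀ᵐ k ∂ν, seqToAtomic hp hν x k = (atomWeight p ν k)⁻¹ * x k := coeFn_natMk ν _

lemma norm_seqToAtomic_le (x : lp (fun _ : ℕ => ℝ) p) : ‖seqToAtomic hp hν x‖ ≤ ‖x‖ := by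
  rw [← enorm_le_iff_norm_le, Lp.enorm_def]
  exact eLpNorm_seqToAtomic_le hp hν x

/-- Holds even with null atoms, which do not affect classes modulo `ν`; the reverse composition is
the identity only if every atom has positive mass. -/
lemma seqToAtomic_atomicToSeq (f : Lp ℝ p ν) :
    seqToAtomic hp hν (atomicToSeq hp hν f) = f := by
  refine Lp.ext ?_
  filter_upwards [coeFn_seqToAtomic hp hν (atomicToSeq hp hν f),
    ae_iff_of_countable.2 fun k hk => hk] with k h1 hk
  rw [h1, atomicToSeq_apply, inv_mul_cancel_left₀ (atomWeight_pos hν hk).ne']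

lemma atomicToSeq_seqToAtomic (h0 : ∀ k, ν {k} ≠ 0) (x : lp (fun _ : ℕ => ℝ) p) :
    atomicToSeq hp hν (seqToAtomic hp hν x) = x := by
  ext k
  rw [atomicToSeq_apply, ae_iff_of_countable.1 (coeFn_seqToAtomic hp hν x) k (h0 k),
    mul_inv_cancel_left₀ (atomWeight_pos hν (h0 k)).ne']

end Atomic

/-! ### `Lip₀` of Lebesgue spaces -/

section LipLebesgue

open Filter Topology OrliczSpace

variable {p : ℝ≥0∞} [hp1 : Fact (1 ≤ p)] (hp : p ≠ ∞)

section Fiber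

variable {Ω : Type*} [MeasurableSpace Ω] {μ : Measure Ω} {ν : Measure ℕ} {π : Ω → ℕ}
  (hπ : MeasurePreserving π μ ν) (hν : ∀ k, ν {k} ≠ ∞)

/-- The normalized averages over the fibres of a measurable map, as an operator `L_p(μ) → ℓ_p`. -/
noncomputable def fiberToSeq : Lp ℝ p μ →ₗ[ℝ] lp (fun _ : ℕ => ℝ) p :=
  atomicToSeq hp hν ∘ₗ orliczToLp hp ∘ₗ averageLM hπ hν ∘ₗ lpToOrlicz hp

/-- The functions that are constant on the fibres of a measurable map, as an operator
`ℓ_p → L_p(μ)`. -/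
noncomputable def seqToFiber : lp (fun _ : ℕ => ℝ) p →ₗ[ℝ] Lp ℝ p μ :=
  orliczToLp hp ∘ₗ fiberLM hπ ∘ₗ lpToOrlicz hp ∘ₗ seqToAtomic hp hν

lemma norm_fiberToSeq_le (f : Lp ℝ p μ) : ‖fiberToSeq hp hπ hν f‖ ≤ ‖f‖ := by
  refine (norm_atomicToSeq_le hp hν _).trans ((norm_orliczToLp hp _).le.trans ?_)
  exact (norm_averageLM_le hπ hν _).trans (norm_lpToOrlicz hp f).le

lemma norm_seqToFiber_le (x : lp (fun _ : ℕ => ℝ) p) : ‖seqToFiber hp hπ hν x‖ ≤ ‖x‖ := by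
  refine (norm_orliczToLp hp _).le.trans ((norm_fiberLM_le hπ _).trans ?_)
  exact (norm_lpToOrlicz hp _).le.trans (norm_seqToAtomic_le hp hν x)

lemma seqToFiber_fiberToSeq (f : Lp ℝ p μ) : seqToFiber hp hπ hν (fiberToSeq hp hπ hν f)
    = orliczToLp hp (fiberLM hπ (averageLM hπ hν (lpToOrlicz hp f))) := by
  simp [seqToFiber, fiberToSeq, seqToAtomic_atomicToSeq]

lemma fiberToSeq_seqToFiber (h0 : ∀ k, ν {k} ≠ 0) (x : lp (fun _ : ℕ => ℝ) p) :
    fiberToSeq hp hπ hν (seqToFiber hp hπ hν x) = x := by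
  simp [seqToFiber, fiberToSeq, averageLM_fiberLM, atomicToSeq_seqToAtomic hp hν h0]

end Fiber

include hp in
/-- `Lip₀(L_p(s)) ≃ Lip₀(ℓ_p)` for a set `s` of half-line type that admits a measurable partition
into countably many sets of positive finite measure. -/
theorem nonempty_lipZero_Lp_equiv {s : Set ℝ} (hsm : MeasurableSet s) (hs : s ⊆ Set.Ici 0)
    (hint : ∀ᵐ x ∂volume.restrict s, s ∈ 𝓝 x) {π : ℝ → ℕ} (hπ : Measurable π)
    (h0 : ∀ k, (volume.restrict s).map π {k} ≠ 0) (h1 : ∀ k, (volume.restrict s).map π {k} ≠ ∞) :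
    Nonempty (LipZero (lp (fun _ : ℕ => ℝ) p) 0 ≃L[ℝ]
      LipZero (Lp ℝ p (volume.restrict s)) 0) := by
  have hα : ∀ n : ℕ, (0 : ℝ) < 1 / (n + 1) := fun n => Nat.one_div_pos_of_nat
  have hfin : ∀ n : ℕ, ∀ k, (volume.restrict s).map (cell (1 / (n + 1))) {k} ≠ ∞ := fun n =>
    map_cell_singleton_ne_top (hα n) hs
  have hπ' : MeasurePreserving π (volume.restrict s) _ := hπ.measurePreserving _
  have hconv : ∀ f : Lp ℝ p (volume.restrict s), Tendsto (fun n : ℕ =>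
      seqToFiber hp (measurePreserving_cell (s := s) (1 / ((n : ℝ) + 1))) (hfin n)
        (fiberToSeq hp (measurePreserving_cell (s := s) (1 / ((n : ℝ) + 1))) (hfin n) f))
      atTop (𝓝 f) := fun f => by
    have h := tendsto_fiberLM_averageLM_cell hsm hs hint hα
      tendsto_one_div_add_atTop_nhds_zero_nat (lpToOrlicz hp f)
    rw [tendsto_iff_norm_sub_tendsto_zero] at h ⊢
    refine h.congr fun n => ?_
    rw [seqToFiber_fiberToSeq, ← norm_orliczToLp hp, map_sub, orliczToLp_lpToOrlicz]
  -- Two partitions play different roles. Cells of length `1 / (n + 1)` approximate the identity but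
  -- may be null from some index on, as in `[0, 1]`; the partition `π`, all of whose fibres have
  -- positive measure, exhibits `ℓ_p` as complemented.
  obtain ⟨e⟩ := LipZero.nonempty_equiv_of_factor
    (fun n : ℕ => fiberToSeq hp (measurePreserving_cell (s := s) (1 / ((n : ℝ) + 1))) (hfin n))
    (fun n : ℕ => seqToFiber hp (measurePreserving_cell (s := s) (1 / ((n : ℝ) + 1))) (hfin n))
    1 zero_le_one (fun n f => by rw [one_mul]; exact norm_fiberToSeq_le _ _ _ f)
    (fun n f => by rw [one_mul]; exact norm_seqToFiber_le _ _ _ f) hconv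
    (fiberToSeq hp hπ' h1) (seqToFiber hp hπ' h1)
    (fun f => by rw [one_mul]; exact norm_fiberToSeq_le _ _ _ f)
    (fun f => by rw [one_mul]; exact norm_seqToFiber_le _ _ _ f)
    (fiberToSeq_seqToFiber hp hπ' h1 h0)
  exact ⟨e.symm⟩

/-- The partition of `(0, 1]` into the intervals `(1 / (k + 2), 1 / (k + 1)]`. -/
noncomputable def harmonicCell (x : ℝ) : ℕ := ⌊1 / x⌋₊ - 1

lemma measurable_harmonicCell : Measurable harmonicCell :=
  (measurable_of_countable fun k : ℕ => k - 1).comp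
    (Nat.measurable_floor.comp (measurable_const.div measurable_id))

/-- For `x` in `(1/(k+2), 1/(k+1))` one has `⌊1/x⌋ = k + 1`, so the fibre contains a nonempty open
interval. -/
lemma map_harmonicCell_ne_zero (k : ℕ) :
    (volume.restrict (Set.Icc (0 : ℝ) 1)).map harmonicCell {k} ≠ 0 := by
  have hk1 : (0 : ℝ) < k + 1 := by positivity
  have hk2 : (0 : ℝ) < k + 2 := by positivity
  have hlt : 1 / ((k : ℝ) + 2) < 1 / (k + 1) := one_div_lt_one_div_of_lt hk1 (by linarith)
  have hle : 1 / ((k : ℝ) + 1) ≤ 1 := by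
    rw [div_le_one hk1]
    linarith [(k.cast_nonneg : (0 : ℝ) ≤ k)]
  have hm := measurable_harmonicCell (measurableSet_singleton k)
  rw [Measure.map_apply measurable_harmonicCell (measurableSet_singleton k),
    Measure.restrict_apply hm]
  refine ((?_ : (0 : ℝ≥0∞) < _).trans_le (measure_mono (?_ :
    Set.Ioo (1 / ((k : ℝ) + 2)) (1 / (k + 1)) ⊆ _))).ne'
  · rw [Real.volume_Ioo]
    exact ENNReal.ofReal_pos.2 (sub_pos.2 hlt)
  · intro x hx
    have hx0 : 0 < x := (one_div_pos.2 hk2).trans hx.1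
    refine ⟨?_, hx0.le, hx.2.le.trans hle⟩
    have hfl : ⌊1 / x⌋₊ = k + 1 := by
      rw [Nat.floor_eq_iff (one_div_pos.2 hx0).le]
      push_cast
      refine ⟨((lt_one_div hx0 hk1).1 hx.2).le, ((one_div_lt hk2 hx0).1 hx.1).trans_eq ?_⟩
      ring
    change ⌊1 / x⌋₊ - 1 = k
    rw [hfl, Nat.add_sub_cancel]

include hp in
theorem nonempty_lipZero_Lp_halfLine_equiv :
    Nonempty (LipZero (lp (fun _ : ℕ => ℝ) p) 0 ≃L[ℝ]
      LipZero (Lp ℝ p (volume.restrict (Set.Ici (0 : ℝ)))) 0) :=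
  nonempty_lipZero_Lp_equiv hp measurableSet_Ici subset_rfl ae_Ici_mem_nhds (measurable_cell 1)
    (fun k => by
      rw [map_cell_Ici_singleton one_pos]
      simp) (map_cell_singleton_ne_top one_pos subset_rfl)

include hp in
theorem nonempty_lipZero_Lp_unitInterval_equiv :
    Nonempty (LipZero (lp (fun _ : ℕ => ℝ) p) 0 ≃L[ℝ]
      LipZero (Lp ℝ p (volume.restrict (Set.Icc (0 : ℝ) 1))) 0) :=
  nonempty_lipZero_Lp_equiv hp measurableSet_Icc Set.Icc_subset_Ici_self ae_Icc_mem_nhds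
    measurable_harmonicCell map_harmonicCell_ne_zero fun k => by
      rw [Measure.map_apply measurable_harmonicCell (measurableSet_singleton k)]
      exact measure_ne_top _ _

end LipLebesgue

theorem mainTheorem3 :
    (∀ (Φ : YoungFunctionDelta2) (α : ℕ → ℝ≥0) (hα : ∀ n, 0 < α n),
      Filter.Tendsto α Filter.atTop (nhds 0) →
      Nonempty (LipZero (OrliczHalfLine Φ) 0 ≃L[ℝ]
        lp (fun n : ℕ => LipZero (OrliczSeq (Φ.scale (α n) (hα n))) 0) ∞)) ∧
    (∀ (p : ℝ≥0∞) [Fact (1 ≤ p)], p ≠ ∞ →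
      Nonempty (LipZero (lp (fun _ : ℕ => ℝ) p) 0 ≃L[ℝ]
        LipZero (Lp ℝ p (volume.restrict (Set.Ici (0 : ℝ)))) 0) ∧
      Nonempty (LipZero (lp (fun _ : ℕ => ℝ) p) 0 ≃L[ℝ]
        LipZero (Lp ℝ p (volume.restrict (Set.Icc (0 : ℝ) 1))) 0)) := by
  exact ⟨fun Φ α hα hlim => OrliczSpace.nonempty_lipZero_halfLine_equiv Φ α hα hlim,
    fun p _ hp => ⟨nonempty_lipZero_Lp_halfLine_equiv hp,
      nonempty_lipZero_Lp_unitInterval_equiv hp⟩⟩
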